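/- Work over $\mathbb{C}$. For integers $d$ and $m_0,n,m\ge 0$ let $\ell(d,m_0,n,m)$ be the minimum, over all $(n+1)$-tuples of points $p_0,\dots,p_n\in\mathbb{P}^2$ (equivalently, the value for general points), of the projective dimension of the linear system of plane curves of degree $d$ with multiplicity at least $m_0$ at $p_0$ and at least $m$ at $p_1,\dots,p_n$; the empty system has dimension $-1$, and the system is empty if $d<0$. Let $X_0=\mathbb{P}\cup\mathbb{F}$ be the fibre over $0$ of the blow-up of $\mathbb{P}^2\times\Delta$ (where $\Delta$ is a disc around $0$) along a line $L\subset\mathbb{P}^2\times\{0\}$. Here $\mathbb{P}\cong\mathbb{P}^2$ is the proper transform of $\mathbb{P}^2\times\{0\}$, $\mathbb{F}\cong\mathbb{F}_1$ is the exceptional divisor, and they meet transversally along a curve $R$, which is the line $L$ in $\mathbb{P}$ and the exceptional curve $E$ of $\mathbb{F}_1$ in $\mathbb{F}$; the identification of $E$ with $L$ is given by the projection $\mathbb{F}\to L$. Let $H$ be the class on $\mathbb{F}$ of the pull-back of a line under the blow-down of $E$. Let $d,m_0,m,n,b\ge 0$ and $k$ be integers with $b\le n$ and $k\le d$. Let $\mathcal{X}(d,k)$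 be the line bundle on $X_0$ that restricts to $\mathcal{O}_{\mathbb{P}}(d-k)$ on $\mathbb{P}$ and to $\mathcal{O}_{\mathbb{F}}(dH-(d-k)E)$ on $\mathbb{F}$; its sections are the pairs of sections on $\mathbb{P}$ and on $\mathbb{F}$ that agree on $R$. For general points $p_0,\dots,p_{n-b}\in\mathbb{P}$ and $p_{n-b+1},\dots,p_n\in\mathbb{F}$ let $\mathcal{L}_0$ be the linear system on $X_0$ given by the sections of $\mathcal{X}(d,k)$ that have multiplicity at least $m_0$ at $p_0$ and at least $m$ at $p_1,\dots,p_n$, and let $\ell_0$ be its (projective) dimension. Put \[ \begin{aligned} \ell_{\mathbb{P}}&=\ell(d-k,m_0,n-b,m), & \ell_{\mathbb{F}}&=\ell(d,d-k,b,m),\\ \hat\ell_{\mathbb{P}}&=\ell(d-k-1,m_0,n-b,m), & \hat\ell_{\mathbb{F}}&=\ell(d,d-k+1,b,m),\\ r_{\mathbb{P}}&=\ell_{\mathbb{P}}-\hat\ell_{\mathbb{P}}-1, & r_{\mathbb{F}}&=\ell_{\mathbb{F}}-\hat\ell_{\mathbb{F}}-1 . \end{aligned} \] Then, for all choices of the points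 in some nonempty Zariski open set: (a) If $r_{\mathbb{P}}+r_{\mathbb{F}}\le d-k-1$, then $\ell_0=\hat\ell_{\mathbb{P}}+\hat\ell_{\mathbb{F}}+1$. (b) If $r_{\mathbb{P}}+r_{\mathbb{F}}\ge d-k-1$, then $\ell_0=\ell_{\mathbb{P}}+\ell_{\mathbb{F}}-d+k$. -/

import Mathlib

namespace PlaneDegeneration

noncomputable section

open MvPolynomial

/-! ## Multiplicity and plane curves

The projective plane is used through homogeneous coordinates `(x, y, z)`, so a point is a nonzero
vector of `ℂ³`, and a curve of degree `d` is given by a form of degree `d`. -/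

/-- The polynomials that vanish to order at least `m` at the point `v` of affine space: the `m`-th
power of the maximal ideal of `v`, as a complex vector space. For a form in the homogeneous
coordinates of the plane (or of the ruled surface below) this does not depend on the choice of the
homogeneous coordinates `v` of a point, and says that the curve it defines has multiplicity at
least `m` at that point, because the passage from homogeneous coordinates to points is a
submersion. -/
def multAtLeast {σ : Type} (m : ℕ) (v : σ → ℂ) : Submodule ℂ (MvPolynomial σ ℂ) :=
  ((Ideal.span (Set.range fun i => (X i - C (v i) : MvPolynomial σ ℂ))) ^ m).restrictScalars ℂ

/-- Homogeneous coordinates `(x, y, z)` of the points of the plane. -/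
abbrev PlanePt : Type := {v : Fin 3 → ℂ // v ≠ 0}

/-- `H⁰(ℙ², 𝒪(d))`: the forms of degree `d` in `x, y, z` (the zero space if `d < 0`). -/
def planeForms (d : ℤ) : Submodule ℂ (MvPolynomial (Fin 3) ℂ) :=
  weightedHomogeneousSubmodule ℂ (fun _ => (1 : ℤ)) d

/-- The vector space of forms of degree `d` with multiplicity at least `m₀` at `p 0` and at least
`m` at `p 1, …, p n`. Its projectivization is the linear system `ℒ(d, m₀, n, m)` based at `p`. -/
def planeSystem (d : ℤ) (m₀ n m : ℕ) (p : Fin (n + 1) → PlanePt) :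
    Submodule ℂ (MvPolynomial (Fin 3) ℂ) :=
  planeForms d ⊓ multAtLeast m₀ (p 0).1 ⊓ ⨅ i : Fin n, multAtLeast m (p i.succ).1

/-- The dimension `ℓ(d, m₀, n, m)`: the minimum over all `(n + 1)`-tuples of points of the plane
of the projective dimension of the linear system based at them (`-1` for the empty system). -/
def ell (d : ℤ) (m₀ n m : ℕ) : ℤ :=
  ((⨅ p : Fin (n + 1) → PlanePt, Module.finrank ℂ (planeSystem d m₀ n m p) : ℕ) : ℤ) - 1

/-! ## The reducible surface `X₀ = ℙ ∪ 𝔽`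

Blow up the line `z = t = 0` in `ℙ² × Δ`, where `t` is the coordinate on `Δ`. The fibre over
`t = 0` is the union of the proper transform `ℙ` of the plane, with homogeneous coordinates
`x, y, z`, and of the exceptional divisor `𝔽`, a surface `𝔽₁` ruled over the line by `[x : y]`,
with homogeneous (Cox) coordinates `x, y, z, s`. They meet along the double curve `R`, which is
the line `L : z = 0` of `ℙ` and the exceptional curve `E : s = 0` of `𝔽`; both carry the
coordinates `[x : y]`. The blow-down of `E` is the map `𝔽 → ℙ²`, `[xs : ys : z]`. -/

/-- Homogeneous coordinates `(x, y, z, s)` of the points of `𝔽`: neither `x = y = 0` nor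
`z = s = 0`. Two of them give the same point if they differ by the action
`(x, y, z, s) ↦ (λx, λy, μz, λ⁻¹μs)` of `λ, μ ∈ ℂˣ`. -/
abbrev RuledPt : Type :=
  {v : Fin 4 → ℂ // (v 0 ≠ 0 ∨ v 1 ≠ 0) ∧ (v 2 ≠ 0 ∨ v 3 ≠ 0)}

/-- The classes of the curves `x = 0`, `y = 0`, `z = 0`, `s = 0` in `Pic 𝔽`, in the basis `H, E`,
where `H` is the class of a line and `E` that of the exceptional curve:
they are `H - E`, `H - E`, `H` and `E`. -/
def ruledClass : Fin 4 → ℤ × ℤ := ![(1, -1), (1, -1), (1, 0), (0, 1)]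

/-- `H⁰(𝔽, 𝒪(d H - e E))`: the polynomials in `x, y, z, s` all of whose monomials have class
`d H - e E`. -/
def ruledForms (d e : ℤ) : Submodule ℂ (MvPolynomial (Fin 4) ℂ) :=
  weightedHomogeneousSubmodule ℂ ruledClass (d, -e)

/-- The sections of `𝒪(d H - e E)` on `𝔽` with multiplicity at least `m` at the `b` points `q`. -/
def ruledSystem (d e : ℤ) (b m : ℕ) (q : Fin b → RuledPt) :
    Submodule ℂ (MvPolynomial (Fin 4) ℂ) :=
  ruledForms d e ⊓ ⨅ i : Fin b, multAtLeast m (q i).1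

/-- Restriction of forms on `ℙ` to `R`: pull-back along `[x : y] ↦ [x : y : 0]`. -/
def restrictPlane : MvPolynomial (Fin 3) ℂ →ₗ[ℂ] MvPolynomial (Fin 2) ℂ :=
  (aeval ![X 0, X 1, 0]).toLinearMap

/-- Restriction of forms on `𝔽` to `R`: pull-back along `[x : y] ↦ (x, y, 1, 0)`. -/
def restrictRuled : MvPolynomial (Fin 4) ℂ →ₗ[ℂ] MvPolynomial (Fin 2) ℂ :=
  (aeval ![X 0, X 1, 1, 0]).toLinearMap

/-- The vector space of sections on `X₀` of the line bundle `𝒳(d, k)`, which restricts to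
`𝒪(d - k)` on `ℙ` and to `𝒪(d H - (d - k) E)` on `𝔽`, with multiplicity at least `m₀` at the first
point `p 0` of `ℙ` and at least `m` at the `a` points `p 1, …, p a` of `ℙ` and at the `b` points
`q` of `𝔽`. Such a section is a pair of sections on `ℙ` and on `𝔽` with the same restriction
to `R`. -/
def limitSystem (d k : ℤ) (m₀ a b m : ℕ) (p : Fin (a + 1) → PlanePt) (q : Fin b → RuledPt) :
    Submodule ℂ (MvPolynomial (Fin 3) ℂ × MvPolynomial (Fin 4) ℂ) :=
  (planeSystem (d - k) m₀ a m p).prod (ruledSystem d (d - k) b m q) ⊓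
    LinearMap.eqLocus (restrictPlane ∘ₗ LinearMap.fst ℂ _ _)
      (restrictRuled ∘ₗ LinearMap.snd ℂ _ _)

/-- The dimension of the linear system `ℒ₀` on `X₀` based at the points `p` and `q`. -/
def limitDim (d k : ℤ) (m₀ a b m : ℕ) (p : Fin (a + 1) → PlanePt) (q : Fin b → RuledPt) : ℤ :=
  (Module.finrank ℂ (limitSystem d k m₀ a b m p q) : ℤ) - 1

/-- `Q` holds for `a + 1` general points of `ℙ` and `b` general points of `𝔽`: it holds on a
nonempty Zariski open set, here the locus where some nonzero polynomial in the homogeneous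
coordinates of all these points does not vanish. -/
def ForGeneralPoints (a b : ℕ)
    (Q : (Fin (a + 1) → PlanePt) → (Fin b → RuledPt) → Prop) : Prop :=
  ∃ g : MvPolynomial ((Fin (a + 1) × Fin 3) ⊕ (Fin b × Fin 4)) ℂ, g ≠ 0 ∧
    ∀ (p : Fin (a + 1) → PlanePt) (q : Fin b → RuledPt),
      eval (Sum.elim (fun i => (p i.1).1 i.2) (fun j => (q j.1).1 j.2)) g ≠ 0 → Q p q

/-! ## The dimensions in a `(k, b)`-degeneration -/

/-- `ℓ_ℙ = ℓ(d - k, m₀, n - b, m)`, the dimension of the system on `ℙ`. -/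
def ellP (d : ℕ) (k : ℤ) (m₀ n b m : ℕ) : ℤ := ell (d - k) m₀ (n - b) m

/-- `ℓ_𝔽 = ℓ(d, d - k, b, m)`, the dimension of the system on `𝔽`. -/
def ellF (d : ℕ) (k : ℤ) (b m : ℕ) : ℤ := ell d (d - k).toNat b m

/-- `ℓ̂_ℙ = ℓ(d - k - 1, m₀, n - b, m)`, the dimension of the kernel system on `ℙ`. -/
def ellHatP (d : ℕ) (k : ℤ) (m₀ n b m : ℕ) : ℤ := ell (d - k - 1) m₀ (n - b) m

/-- `ℓ̂_𝔽 = ℓ(d, d - k + 1, b, m)`, the dimension of the kernel system on `𝔽`. -/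
def ellHatF (d : ℕ) (k : ℤ) (b m : ℕ) : ℤ := ell d (d - k + 1).toNat b m

/-- `r_ℙ = ℓ_ℙ - ℓ̂_ℙ - 1`, the dimension of the system on `R` restricted from `ℙ`. -/
def rP (d : ℕ) (k : ℤ) (m₀ n b m : ℕ) : ℤ := ellP d k m₀ n b m - ellHatP d k m₀ n b m - 1

/-- `r_𝔽 = ℓ_𝔽 - ℓ̂_𝔽 - 1`, the dimension of the system on `R` restricted from `𝔽`. -/
def rF (d : ℕ) (k : ℤ) (b m : ℕ) : ℤ := ellF d k b m - ellHatF d k b m - 1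

end

end PlaneDegeneration

/-!
A section of the limit bundle is a pair of sections on the two components with the same restriction
to `R`, so the dimension of the limit system is determined by the dimensions of the systems on `ℙ`
and on `𝔽` and by that of the sum of their restrictions `V` and `W` to `R`, two spaces of
binary forms of degree `d - k` (`finrank_limitSystem_add`). The kernels of the restrictions are `z`
times forms of degree `d - k - 1`, and `s` times sections of `𝒪(d H - (d - k + 1) E)`
(`finrank_planeSystem_eq`, `finrank_ruledSystem_eq`). So `V` and `W` have dimensions `r_ℙ + 1` and
`r_𝔽 + 1`, once the systems on the components have their least dimensions, and both
formulas say that `V` and `W` are transversal: `V + W` has dimension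
`min (dim V + dim W) (d - k + 1)`.

Systems on `𝔽` become systems on the plane by blowing down `E`
(`finrank_ruledSystem_eq_planeSystem`); as the projective group is transitive on points, requiring
one of the points to be `[0 : 0 : 1]` does not change the least dimension
(`exists_finrank_ruledSystem_eq`).

All the spaces in question are cut out by linear equations with coefficients polynomial in the
coordinates of the points, so that their dimensions are upper semicontinuous
(`IsAlgebraicFamily.exists_finrank_le`). Hence it is enough to find one choice of points where `V`
and `W` are transversal. The matrices in `GL₂` that act on the coordinates `x, y` move the points on
`ℙ`, and with them `V`, without moving `R`. Thus transversality follows from a statement about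
binary forms (`exists_linSubst_transversal`): any two spaces of binary forms of degree `e` become
transversal after a linear change of variables in one of them. For this one may assume that
the dimensions `v` and `w` of the two spaces satisfy `v + w ≤ e + 1`. In characteristic zero a space
of dimension `v` has no nonzero member that vanishes to order `v` at a general point of the line
(`exists_finset_forall_pow_dvd_imp_eq_zero`), so coordinates can be chosen in which the first space
has this property at `x = 0` and the second one at `y = 0`. The torus `x ↦ t x` then
makes the spaces disjoint for large `t` (`exists_scaling_disjoint`).
-/

namespace PlaneDegeneration

noncomputable section

/-! ### Vanishing orders of a space of polynomials in one variable -/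

section VanishingOrders

open Polynomial

/-- A vanishing Wronskian forces proportionality, in characteristic zero: here `g` is normalized so
that it has no term of degree `f.natDegree`. -/
theorem eq_zero_of_wronskian_eq_zero {f g : ℂ[X]} (hf : f ≠ 0) (hg : g.coeff f.natDegree = 0)
    (h : f * derivative g = derivative f * g) : g = 0 := by
  by_contra hg0
  have h1 : f * (X * derivative g) = (X * derivative f) * g := by
    linear_combination X * h
  have hdeg : ∀ q : ℂ[X], (X * derivative q).natDegree ≤ q.natDegree := fun q => by
    refine natDegree_le_iff_coeff_eq_zero.2 fun n hn => ?_
    cases n with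
    | zero => simp
    | succ n => rw [coeff_X_mul, coeff_derivative, coeff_eq_zero_of_natDegree_lt hn, zero_mul]
  have hco : ∀ q : ℂ[X], (X * derivative q).coeff q.natDegree = q.natDegree * q.leadingCoeff :=
    fun q => by
      rw [leadingCoeff]
      cases hq : q.natDegree with
      | zero => simp
      | succ n => rw [coeff_X_mul, coeff_derivative]; push_cast; ring
  have h2 := congrArg (fun q => q.coeff (f.natDegree + g.natDegree)) h1
  simp only [coeff_mul_add_eq_of_natDegree_le le_rfl (hdeg g),
    coeff_mul_add_eq_of_natDegree_le (hdeg f) le_rfl, hco, coeff_natDegree] at h2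
  have hf' : f.leadingCoeff ≠ 0 := leadingCoeff_ne_zero.2 hf
  have hg' : g.leadingCoeff ≠ 0 := leadingCoeff_ne_zero.2 hg0
  have h3 : (g.natDegree : ℂ) = f.natDegree := by
    apply mul_left_cancel₀ (mul_ne_zero hf' hg')
    linear_combination h2
  rw [Nat.cast_inj] at h3
  exact hg' (by rw [leadingCoeff, h3, hg])

/-- At all but finitely many points `c`, the vanishing orders of a space of polynomials of
dimension `v` are as small as possible, so that no nonzero member vanishes to order `v`. The proof
is by induction on the dimension, passing from `V` to the Wronskians of its members with a
fixed one. -/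
theorem exists_finset_forall_pow_dvd_imp_eq_zero (v : ℕ) (V : Submodule ℂ ℂ[X])
    [FiniteDimensional ℂ V] (hV : Module.finrank ℂ V ≤ v) :
    ∃ s : Finset ℂ, ∀ c ∉ s, ∀ f ∈ V, (X - C c) ^ v ∣ f → f = 0 := by
  induction v generalizing V with
  | zero =>
    have : V = ⊥ := Submodule.finrank_eq_zero.1 (Nat.le_zero.1 hV)
    exact ⟨∅, fun c _ f hf _ => by simpa [this] using hf⟩
  | succ n ih =>
    by_cases hbot : V = ⊥
    · exact ⟨∅, fun c _ f hf _ => by simpa [hbot] using hf⟩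
    obtain ⟨f₀, hf₀, hne⟩ := Submodule.exists_mem_ne_zero_of_ne_bot hbot
    -- The kernel of `D` on `V` is spanned by `f₀`, so `D V` has smaller dimension; and `D` lowers the
    -- order of vanishing at any point by at most one.
    let D : ℂ[X] →ₗ[ℂ] ℂ[X] :=
      LinearMap.mulLeft ℂ f₀ ∘ₗ derivative - LinearMap.mulLeft ℂ (derivative f₀)
    have hD : ∀ f, D f = f₀ * derivative f - derivative f₀ * f := fun f => rfl
    have hrank := (D.domRestrict V).finrank_range_add_finrank_ker
    rw [LinearMap.range_domRestrict] at hrank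
    have hker : 0 < Module.finrank ℂ (LinearMap.ker (D.domRestrict V)) := by
      refine (Module.finrank_pos_iff_exists_ne_zero (R := ℂ)).2
        ⟨(⟨⟨f₀, hf₀⟩, ?_⟩ : LinearMap.ker (D.domRestrict V)), ?_⟩
      · simp [hD, mul_comm]
      · simpa [Subtype.ext_iff] using hne
    obtain ⟨s, hs⟩ := ih (V.map D) (by omega)
    refine ⟨s ∪ f₀.roots.toFinset, fun c hc f hf hdvd => ?_⟩
    rw [Finset.mem_union, not_or, Multiset.mem_toFinset, mem_roots hne] at hc
    have hDf : D f = 0 := by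
      refine hs c hc.1 _ (Submodule.mem_map_of_mem hf) ?_
      obtain ⟨g, rfl⟩ := hdvd
      refine ⟨f₀ * (((n : ℂ[X]) + 1) * g + (X - C c) * derivative g) -
        derivative f₀ * ((X - C c) * g), ?_⟩
      rw [hD, derivative_mul, derivative_X_sub_C_pow]
      push_cast
      simp only [pow_succ]
      simp only [map_add, map_natCast, map_one]
      ring
    have hfac : f = C (f.coeff f₀.natDegree / f₀.leadingCoeff) * f₀ := by
      rw [← sub_eq_zero]
      refine eq_zero_of_wronskian_eq_zero hne ?_ ?_
      · rw [coeff_sub, coeff_C_mul, coeff_natDegree,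
          div_mul_cancel₀ _ (leadingCoeff_ne_zero.2 hne), sub_self]
      · rw [hD, sub_eq_zero] at hDf
        rw [derivative_sub, derivative_C_mul]
        linear_combination hDf
    have hroot : f.eval c = 0 :=
      dvd_iff_isRoot.1 ((dvd_pow_self _ n.succ_ne_zero).trans hdvd)
    rw [hfac, eval_mul, eval_C] at hroot
    rcases mul_eq_zero.1 hroot with h0 | h0
    · rw [hfac, h0, C_0, zero_mul]
    · exact absurd h0 hc.2

end VanishingOrders

/-! ### The one-parameter torus -/

/-- If `V` meets the last coordinates trivially and `W` the first ones, then a large `t` moves `W`,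
by scaling the `i`-th coordinate by `t ^ i`, to a space that meets `V` trivially: the
last coordinates are dominated by the first ones on `V`, and the first by the last on `W`, and
the scaling makes the second bound as sharp as one likes. -/
theorem exists_scaling_disjoint {N v : ℕ} (V W : Submodule ℂ (Fin N → ℂ))
    (hV : ∀ x ∈ V, (∀ i : Fin N, (i : ℕ) < v → x i = 0) → x = 0)
    (hW : ∀ y ∈ W, (∀ i : Fin N, v ≤ (i : ℕ) → y i = 0) → y = 0) :
    ∃ t : ℂ, t ≠ 0 ∧ ∀ x ∈ V, ∀ y ∈ W, (∀ i : Fin N, x i = t ^ (i : ℕ) * y i) → x = 0 := by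
  have key : ∀ (U : Submodule ℂ (Fin N → ℂ)) (s : Fin N → Prop) [DecidablePred s],
      (∀ x ∈ U, (∀ i, s i → x i = 0) → x = 0) →
      ∃ K : ℝ, 0 < K ∧ ∀ x ∈ U, ‖x‖ ≤ K * ‖fun i => if s i then x i else 0‖ := by
    intro U s _ hU
    let L : (Fin N → ℂ) →ₗ[ℂ] (Fin N → ℂ) :=
      LinearMap.pi fun i => if s i then LinearMap.proj i else 0
    have hL : ∀ x, L x = fun i => if s i then x i else 0 := fun x => by
      ext i
      by_cases h : s i <;> simp [L, h]
    have hker : LinearMap.ker (L.domRestrict U) = ⊥ := by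
      refine LinearMap.ker_eq_bot'.2 fun x hx => Subtype.ext (hU x x.2 fun i hi => ?_)
      rw [LinearMap.domRestrict_apply, hL] at hx
      simpa [hi] using congrFun hx i
    obtain ⟨K, hK0, hK⟩ := LinearMap.exists_antilipschitzWith _ hker
    refine ⟨K, hK0, fun x hx => ?_⟩
    have := hK.le_mul_dist ⟨x, hx⟩ 0
    rw [map_zero, dist_zero_right, dist_zero_right, LinearMap.domRestrict_apply, hL] at this
    simpa using this
  obtain ⟨K, hK0, hK⟩ := key V (fun i => (i : ℕ) < v) hV
  obtain ⟨K', hK'0, hK'⟩ := key W (fun i => v ≤ (i : ℕ)) hW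
  have ht : (1 : ℝ) ≤ K * K' + 1 := by nlinarith
  set t : ℝ := K * K' + 1 with htdef
  have ht0 : (0 : ℝ) < t := by linarith
  refine ⟨(t : ℂ), by exact_mod_cast ht0.ne', fun x hx y hy hxy => ?_⟩
  have hnorm : ∀ i, ‖x i‖ = t ^ (i : ℕ) * ‖y i‖ := fun i => by
    rw [hxy i, norm_mul, norm_pow, Complex.norm_real, Real.norm_of_nonneg ht0.le]
  -- The first coordinates of `x`, up to one power of `t`, are bounded by `t ^ v * ‖y‖`.
  have hlo : t * ‖fun i : Fin N => if (i : ℕ) < v then x i else 0‖ ≤ t ^ v * ‖y‖ := by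
    rw [← le_div_iff₀' ht0]
    refine (pi_norm_le_iff_of_nonneg (by positivity)).2 fun i => ?_
    split_ifs with hi
    · rw [le_div_iff₀' ht0, hnorm, ← mul_assoc, ← pow_succ']
      exact mul_le_mul (pow_le_pow_right₀ ht hi) (norm_le_pi_norm y i) (norm_nonneg _)
        (by positivity)
    · rw [norm_zero]; positivity
  have hhi : t ^ v * ‖fun i : Fin N => if v ≤ (i : ℕ) then y i else 0‖ ≤ ‖x‖ := by
    rw [← le_div_iff₀' (by positivity)]
    refine (pi_norm_le_iff_of_nonneg (by positivity)).2 fun i => ?_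
    split_ifs with hi
    · rw [le_div_iff₀' (by positivity)]
      refine le_trans ?_ (norm_le_pi_norm x i)
      rw [hnorm]
      exact mul_le_mul_of_nonneg_right (pow_le_pow_right₀ ht hi) (norm_nonneg _)
    · rw [norm_zero]; positivity
  set lo := ‖fun i : Fin N => if (i : ℕ) < v then x i else 0‖
  set hi := ‖fun i : Fin N => if v ≤ (i : ℕ) then y i else 0‖
  have hlo0 : 0 ≤ lo := norm_nonneg _
  have h1 : t * lo ≤ K * K' * lo := by
    calc t * lo ≤ t ^ v * ‖y‖ := hlo
      _ ≤ t ^ v * (K' * hi) := by gcongr; exact hK' y hy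
      _ = K' * (t ^ v * hi) := by ring
      _ ≤ K' * ‖x‖ := by gcongr
      _ ≤ K' * (K * lo) := by gcongr; exact hK x hx
      _ = K * K' * lo := by ring
  have h2 : lo = 0 := by nlinarith
  exact norm_le_zero_iff.1 ((hK x hx).trans (by rw [show ‖_‖ = (0 : ℝ) from h2, mul_zero]))

open MvPolynomial

/-! ### Linear substitutions and binary forms -/

/-- Two linear maps on polynomials agree at `f` if they agree at the monomials of `f`. -/
theorem linearMap_eq_of_forall_support {σ M : Type*} [AddCommGroup M] [Module ℂ M]
    (φ ψ : MvPolynomial σ ℂ →ₗ[ℂ] M) (f : MvPolynomial σ ℂ)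
    (h : ∀ α ∈ f.support, φ (monomial α 1) = ψ (monomial α 1)) : φ f = ψ f := by
  rw [f.as_sum, map_sum, map_sum]
  refine Finset.sum_congr rfl fun α hα => ?_
  have : monomial α (f.coeff α) = f.coeff α • monomial α (1 : ℂ) := by
    rw [smul_monomial, smul_eq_mul, mul_one]
  rw [this, map_smul, map_smul, h α hα]

/-- The substitution `f ↦ f ∘ A` for a square matrix `A`. -/
def linSubst {n : ℕ} (A : Matrix (Fin n) (Fin n) ℂ) :
    MvPolynomial (Fin n) ℂ →ₐ[ℂ] MvPolynomial (Fin n) ℂ :=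
  aeval A.toMvPolynomial

theorem linSubst_linSubst {n : ℕ} (A B : Matrix (Fin n) (Fin n) ℂ) (f : MvPolynomial (Fin n) ℂ) :
    linSubst B (linSubst A f) = linSubst (A * B) f := by
  rw [← AlgHom.comp_apply]
  congr 1
  ext i : 1
  rw [AlgHom.comp_apply, linSubst, linSubst, linSubst, aeval_X, aeval_X, Matrix.toMvPolynomial_mul]
  rfl

theorem linSubst_one {n : ℕ} (f : MvPolynomial (Fin n) ℂ) : linSubst 1 f = f := by
  simp [linSubst]

theorem linSubst_inv {n : ℕ} {A : Matrix (Fin n) (Fin n) ℂ} (hA : IsUnit A.det)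
    (f : MvPolynomial (Fin n) ℂ) : linSubst A⁻¹ (linSubst A f) = f := by
  rw [linSubst_linSubst, Matrix.mul_nonsing_inv A hA, linSubst_one]

theorem linSubst_injective {n : ℕ} {A : Matrix (Fin n) (Fin n) ℂ} (hA : IsUnit A.det) :
    Function.Injective (linSubst A) :=
  Function.LeftInverse.injective (linSubst_inv hA)

theorem linSubst_mem_homogeneousSubmodule {n e : ℕ} (A : Matrix (Fin n) (Fin n) ℂ)
    {f : MvPolynomial (Fin n) ℂ} (hf : f ∈ homogeneousSubmodule (Fin n) ℂ e) :
    linSubst A f ∈ homogeneousSubmodule (Fin n) ℂ e := by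
  have := IsHomogeneous.aeval (S := ℂ) hf A.toMvPolynomial A.toMvPolynomial_isHomogeneous
  rwa [one_mul] at this

theorem toMvPolynomial_fin_two (A : Matrix (Fin 2) (Fin 2) ℂ) (i : Fin 2) :
    A.toMvPolynomial i = C (A i 0) * X 0 + C (A i 1) * X 1 := by
  simp [Matrix.toMvPolynomial, Fin.sum_univ_two, ← C_mul_X_eq_monomial]

/-- Dehomogenization `f ↦ f(x, 1)` of binary forms. -/
def dehomogenize : MvPolynomial (Fin 2) ℂ →ₐ[ℂ] Polynomial ℂ :=
  aeval ![Polynomial.X, 1]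

theorem dehomogenize_monomial (α : Fin 2 →₀ ℕ) :
    dehomogenize (monomial α 1) = Polynomial.X ^ α 0 := by
  simp [dehomogenize, aeval_monomial, Finsupp.prod_fintype]

theorem add_eq_of_mem_homogeneousSubmodule {e : ℕ} {f : MvPolynomial (Fin 2) ℂ}
    (hf : f ∈ homogeneousSubmodule (Fin 2) ℂ e) {α : Fin 2 →₀ ℕ} (hα : α ∈ f.support) :
    α 0 + α 1 = e := by
  have := hf (mem_support_iff.1 hα)
  simpa [Finsupp.weight_apply, Finsupp.sum_fintype, Fin.sum_univ_two] using this

theorem coeff_dehomogenize {e : ℕ} {f : MvPolynomial (Fin 2) ℂ}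
    (hf : f ∈ homogeneousSubmodule (Fin 2) ℂ e) {α : Fin 2 →₀ ℕ} (hα : α 0 + α 1 = e) :
    (dehomogenize f).coeff (α 0) = f.coeff α := by
  refine linearMap_eq_of_forall_support (Polynomial.lcoeff ℂ (α 0) ∘ₗ dehomogenize.toLinearMap)
    (lcoeff ℂ α) f fun β hβ => ?_
  have hβ' := add_eq_of_mem_homogeneousSubmodule hf hβ
  have : α 0 = β 0 ↔ β = α := by
    rw [Finsupp.ext_iff, Fin.forall_fin_two]
    omega
  simp [dehomogenize_monomial, Polynomial.coeff_X_pow, coeff_monomial, this]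

theorem eq_zero_of_dehomogenize_coeff {e : ℕ} {f : MvPolynomial (Fin 2) ℂ}
    (hf : f ∈ homogeneousSubmodule (Fin 2) ℂ e)
    (h : ∀ i ≤ e, (dehomogenize f).coeff i = 0) : f = 0 := by
  ext α
  by_cases hα : α ∈ f.support
  · have hsum := add_eq_of_mem_homogeneousSubmodule hf hα
    rw [← coeff_dehomogenize hf hsum, h _ (by omega), coeff_zero]
  · rw [notMem_support_iff.1 hα, coeff_zero]

/-- The coefficients of a binary form of degree `e`, as a vector. -/
def binaryCoeffs (e : ℕ) : MvPolynomial (Fin 2) ℂ →ₗ[ℂ] (Fin (e + 1) → ℂ) :=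
  LinearMap.pi fun i => Polynomial.lcoeff ℂ i ∘ₗ dehomogenize.toLinearMap

theorem binaryCoeffs_apply (e : ℕ) (f : MvPolynomial (Fin 2) ℂ) (i : Fin (e + 1)) :
    binaryCoeffs e f i = (dehomogenize f).coeff i := rfl

theorem finrank_le_of_le_homogeneousSubmodule {e : ℕ} {V : Submodule ℂ (MvPolynomial (Fin 2) ℂ)}
    (hV : V ≤ homogeneousSubmodule (Fin 2) ℂ e) :
    FiniteDimensional ℂ V ∧ Module.finrank ℂ V ≤ e + 1 := by
  have hinj : Function.Injective ((binaryCoeffs e).domRestrict V) := by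
    refine (injective_iff_map_eq_zero _).2 fun f hf => Subtype.ext ?_
    refine eq_zero_of_dehomogenize_coeff (hV f.2) fun i hi => ?_
    exact congrFun hf ⟨i, Nat.lt_succ_of_le hi⟩
  have := FiniteDimensional.of_injective _ hinj
  refine ⟨this, ?_⟩
  simpa using LinearMap.finrank_le_finrank_of_injective hinj

theorem dehomogenize_linSubst_shear (c : ℂ) (f : MvPolynomial (Fin 2) ℂ) :
    dehomogenize (linSubst !![1, c; 0, 1] f) = Polynomial.taylor c (dehomogenize f) := by
  have : dehomogenize.comp (linSubst !![1, c; 0, 1]) =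
      (Polynomial.taylorAlgHom c).comp dehomogenize := by
    ext i : 1
    fin_cases i <;>
      simp [linSubst, dehomogenize, toMvPolynomial_fin_two, Polynomial.algebraMap_eq]
  exact DFunLike.congr_fun this f

theorem dehomogenize_linSubst_scaling (t : ℂ) (f : MvPolynomial (Fin 2) ℂ) (i : ℕ) :
    (dehomogenize (linSubst !![t, 0; 0, 1] f)).coeff i = t ^ i * (dehomogenize f).coeff i := by
  have : dehomogenize.comp (linSubst !![t, 0; 0, 1]) =
      (Polynomial.aeval (Polynomial.C t * Polynomial.X)).comp dehomogenize := by
    ext i : 1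
    fin_cases i <;>
      simp [linSubst, dehomogenize, toMvPolynomial_fin_two, Polynomial.algebraMap_eq]
  have := DFunLike.congr_fun this f
  rw [AlgHom.comp_apply, AlgHom.comp_apply, ← Polynomial.comp_eq_aeval] at this
  rw [this, Polynomial.comp_C_mul_X_coeff, mul_comm]

theorem dehomogenize_linSubst_swap {e : ℕ} {f : MvPolynomial (Fin 2) ℂ}
    (hf : f ∈ homogeneousSubmodule (Fin 2) ℂ e) {i : ℕ} (hi : i ≤ e) :
    (dehomogenize (linSubst !![0, 1; 1, 0] f)).coeff i = (dehomogenize f).coeff (e - i) := by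
  refine linearMap_eq_of_forall_support
    (Polynomial.lcoeff ℂ i ∘ₗ dehomogenize.toLinearMap ∘ₗ (linSubst !![0, 1; 1, 0]).toLinearMap)
    (Polynomial.lcoeff ℂ (e - i) ∘ₗ dehomogenize.toLinearMap) f fun β hβ => ?_
  have hβ' := add_eq_of_mem_homogeneousSubmodule hf hβ
  have h1 : dehomogenize (linSubst !![0, 1; 1, 0] (monomial β 1)) = Polynomial.X ^ β 1 := by
    simp [linSubst, dehomogenize, aeval_monomial, Finsupp.prod_fintype, toMvPolynomial_fin_two,
      -aeval_eq_bind₁]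
  have : e - i = β 0 ↔ i = β 1 := by omega
  simp [h1, dehomogenize_monomial, Polynomial.coeff_X_pow, this]

/-! ### Transversality of spaces of binary forms -/

/-- After a change of coordinates, no nonzero member of `V` vanishes at the point `x = 0` to order
the dimension of `V`. -/
theorem exists_linSubst_vanishing_low {e v : ℕ} {V : Submodule ℂ (MvPolynomial (Fin 2) ℂ)}
    (hV : V ≤ homogeneousSubmodule (Fin 2) ℂ e) (hv : Module.finrank ℂ V ≤ v) :
    ∃ A : Matrix (Fin 2) (Fin 2) ℂ, IsUnit A.det ∧
      ∀ f ∈ V, (∀ i < v, (dehomogenize (linSubst A f)).coeff i = 0) → f = 0 := by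
  have := (finrank_le_of_le_homogeneousSubmodule hV).1
  obtain ⟨s, hs⟩ := exists_finset_forall_pow_dvd_imp_eq_zero v (V.map dehomogenize.toLinearMap)
    ((Submodule.finrank_map_le _ _).trans hv)
  obtain ⟨c, hc⟩ := Infinite.exists_notMem_finset s
  refine ⟨!![1, c; 0, 1], by simp [Matrix.det_fin_two], fun f hf h => ?_⟩
  have hz : dehomogenize f = 0 := by
    refine hs c hc _ (Submodule.mem_map_of_mem hf) ?_
    simp only [dehomogenize_linSubst_shear] at h
    have hdvd := map_dvd (Polynomial.taylorAlgHom (-c)) (Polynomial.X_pow_dvd_iff.2 h)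
    simpa [Polynomial.taylor_taylor, sub_eq_add_neg] using hdvd
  exact eq_zero_of_dehomogenize_coeff (hV hf) fun i _ => by rw [hz, Polynomial.coeff_zero]

/-- The same at the point `y = 0`. -/
theorem exists_linSubst_vanishing_high {e w : ℕ} {W : Submodule ℂ (MvPolynomial (Fin 2) ℂ)}
    (hW : W ≤ homogeneousSubmodule (Fin 2) ℂ e) (hw : Module.finrank ℂ W ≤ w) :
    ∃ A : Matrix (Fin 2) (Fin 2) ℂ, IsUnit A.det ∧
      ∀ f ∈ W, (∀ i ≤ e, e < i + w → (dehomogenize (linSubst A f)).coeff i = 0) → f = 0 := by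
  obtain ⟨A, hA, h⟩ := exists_linSubst_vanishing_low hW hw
  refine ⟨A * !![0, 1; 1, 0], ?_, fun f hf hi => h f hf fun i hiw => ?_⟩
  · rw [Matrix.det_mul]
    exact hA.mul (by simp [Matrix.det_fin_two])
  · by_cases hie : i ≤ e
    · have := hi (e - i) (by omega) (by omega)
      rw [← linSubst_linSubst, dehomogenize_linSubst_swap
        (linSubst_mem_homogeneousSubmodule A (hW hf)) (by omega)] at this
      rwa [show e - (e - i) = i by omega] at this
    · refine Polynomial.coeff_eq_zero_of_natDegree_lt (lt_of_le_of_lt ?_ (not_le.1 hie))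
      have hg := linSubst_mem_homogeneousSubmodule A (hW hf)
      refine Polynomial.natDegree_le_iff_coeff_eq_zero.2 fun j hj => ?_
      refine linearMap_eq_of_forall_support
        (Polynomial.lcoeff ℂ j ∘ₗ dehomogenize.toLinearMap) 0 _ fun β hβ => ?_
      have := add_eq_of_mem_homogeneousSubmodule hg hβ
      simp [dehomogenize_monomial, Polynomial.coeff_X_pow, show j ≠ β 0 by omega]

/-- Two spaces of binary forms of degree `e` whose dimensions add up to at most `e + 1` become
disjoint after a suitable change of coordinates in one of them. -/
theorem exists_linSubst_disjoint {e : ℕ} {V W : Submodule ℂ (MvPolynomial (Fin 2) ℂ)}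
    (hV : V ≤ homogeneousSubmodule (Fin 2) ℂ e) (hW : W ≤ homogeneousSubmodule (Fin 2) ℂ e)
    (hdim : Module.finrank ℂ V + Module.finrank ℂ W ≤ e + 1) :
    ∃ A : Matrix (Fin 2) (Fin 2) ℂ, IsUnit A.det ∧
      Disjoint V (W.map (linSubst A).toLinearMap) := by
  obtain ⟨A₁, hA₁, h₁⟩ := exists_linSubst_vanishing_low hV le_rfl
  obtain ⟨A₂, hA₂, h₂⟩ := exists_linSubst_vanishing_high hW le_rfl
  obtain ⟨t, ht0, ht⟩ := exists_scaling_disjoint (v := Module.finrank ℂ V)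
    (V.map (binaryCoeffs e ∘ₗ (linSubst A₁).toLinearMap))
    (W.map (binaryCoeffs e ∘ₗ (linSubst A₂).toLinearMap))
    (by
      rintro _ ⟨f, hf, rfl⟩ h
      rw [h₁ f hf fun i hi => ?_, map_zero]
      exact h ⟨i, by omega⟩ hi)
    (by
      rintro _ ⟨f, hf, rfl⟩ h
      rw [h₂ f hf fun i hi hiw => ?_, map_zero]
      exact h ⟨i, by omega⟩ (by simp only; omega))
  have hdetT : IsUnit (!![t, 0; 0, 1] : Matrix (Fin 2) (Fin 2) ℂ).det := by
    simpa [Matrix.det_fin_two] using ht0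
  refine ⟨A₂ * !![t, 0; 0, 1] * A₁⁻¹, ?_, ?_⟩
  · rw [Matrix.det_mul, Matrix.det_mul]
    exact (hA₂.mul hdetT).mul (Matrix.isUnit_nonsing_inv_det A₁ hA₁)
  · rw [Submodule.disjoint_def]
    rintro f hf ⟨g, hg, hgf⟩
    have hfg : linSubst A₁ f = linSubst !![t, 0; 0, 1] (linSubst A₂ g) := by
      rw [← hgf, AlgHom.toLinearMap_apply, linSubst_linSubst, linSubst_linSubst, mul_assoc,
        Matrix.nonsing_inv_mul A₁ hA₁, mul_one]
    have hz := ht _ (Submodule.mem_map_of_mem hf) _ (Submodule.mem_map_of_mem hg) fun i => by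
      simp only [LinearMap.comp_apply, AlgHom.toLinearMap_apply, binaryCoeffs_apply, hfg,
        dehomogenize_linSubst_scaling]
    refine h₁ f hf fun i hi => ?_
    exact congrFun hz ⟨i, by omega⟩

/-- Two spaces of binary forms of degree `e` become transversal after a suitable change of
coordinates in one of them. -/
theorem exists_linSubst_transversal {e : ℕ} {V W : Submodule ℂ (MvPolynomial (Fin 2) ℂ)}
    (hV : V ≤ homogeneousSubmodule (Fin 2) ℂ e) (hW : W ≤ homogeneousSubmodule (Fin 2) ℂ e) :
    ∃ A : Matrix (Fin 2) (Fin 2) ℂ, IsUnit A.det ∧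
      min (Module.finrank ℂ V + Module.finrank ℂ W) (e + 1) ≤
        Module.finrank ℂ ↥(V ⊔ W.map (linSubst A).toLinearMap) := by
  obtain ⟨_, hVe⟩ := finrank_le_of_le_homogeneousSubmodule hV
  obtain ⟨_, hWe⟩ := finrank_le_of_le_homogeneousSubmodule hW
  -- Shrink `W` so that the dimensions add up to at most `e + 1`.
  obtain ⟨b, hb⟩ := exists_linearIndependent_of_le_finrank (R := ℂ) (M := W)
    (n := min (Module.finrank ℂ W) (e + 1 - Module.finrank ℂ V)) (min_le_left _ _)
  set W' := Submodule.span ℂ (Set.range fun i => (b i : MvPolynomial (Fin 2) ℂ)) with hW'def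
  have hW'W : W' ≤ W := Submodule.span_le.2 (by rintro _ ⟨i, rfl⟩; exact (b i).2)
  have hW' : Module.finrank ℂ W' =
      min (Module.finrank ℂ W) (e + 1 - Module.finrank ℂ V) := by
    have := finrank_span_eq_card (hb.map' W.subtype W.ker_subtype)
    rwa [Fintype.card_fin] at this
  obtain ⟨A, hA, hdisj⟩ := exists_linSubst_disjoint hV (hW'W.trans hW) (by omega)
  refine ⟨A, hA, ?_⟩
  have := Submodule.finiteDimensional_of_le hW'W
  have hmap : Module.finrank ℂ ↥(W'.map (linSubst A).toLinearMap) = Module.finrank ℂ W' :=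
    (Submodule.equivMapOfInjective _ (linSubst_injective hA) W').finrank_eq.symm
  have h1 := Submodule.finrank_sup_add_finrank_inf_eq V (W'.map (linSubst A).toLinearMap)
  rw [disjoint_iff.1 hdisj, finrank_bot, hmap] at h1
  have h2 : Module.finrank ℂ ↥(V ⊔ W'.map (linSubst A).toLinearMap) ≤
      Module.finrank ℂ ↥(V ⊔ W.map (linSubst A).toLinearMap) :=
    Submodule.finrank_mono (sup_le_sup_left (Submodule.map_mono hW'W) V)
  omega

/-! ### Multiplicity under substitutions -/

section Multiplicity

variable {σ τ : Type}

theorem sub_C_eval_mem_span (w : τ → ℂ) (f : MvPolynomial τ ℂ) :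
    f - C (eval w f) ∈ Ideal.span (Set.range fun i => (X i - C (w i) : MvPolynomial τ ℂ)) := by
  induction f using MvPolynomial.induction_on with
  | C a => simp
  | add p q hp hq =>
    have := Ideal.add_mem _ hp hq
    rwa [show p - C (eval w p) + (q - C (eval w q)) = p + q - C (eval w (p + q)) by
      rw [map_add, map_add]; ring] at this
  | mul_X p i hp =>
    have h1 := Ideal.mul_mem_left _ (X i) hp
    have h2 := Ideal.mul_mem_left _ (C (eval w p))
      (Ideal.subset_span (Set.mem_range_self (f := fun i => (X i - C (w i) : MvPolynomial τ ℂ)) i))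
    have := Ideal.add_mem _ h1 h2
    rwa [show X i * (p - C (eval w p)) + C (eval w p) * (X i - C (w i)) =
      p * X i - C (eval w (p * X i)) by rw [map_mul, map_mul, eval_X]; ring] at this

/-- Pull-back along a polynomial map that takes `w` to `v` preserves multiplicities. -/
theorem aeval_mem_multAtLeast {m : ℕ} {v : σ → ℂ} {w : τ → ℂ} {h : σ → MvPolynomial τ ℂ}
    (hw : ∀ i, eval w (h i) = v i) {f : MvPolynomial σ ℂ} (hf : f ∈ multAtLeast m v) :
    aeval h f ∈ multAtLeast m w := by
  have hle : Ideal.map (aeval h : MvPolynomial σ ℂ →ₐ[ℂ] MvPolynomial τ ℂ)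
      (Ideal.span (Set.range fun i => (X i - C (v i) : MvPolynomial σ ℂ))) ≤
      Ideal.span (Set.range fun i => (X i - C (w i) : MvPolynomial τ ℂ)) := by
    rw [Ideal.map_span, Ideal.span_le]
    rintro _ ⟨_, ⟨i, rfl⟩, rfl⟩
    have := sub_C_eval_mem_span w (h i)
    rw [hw i] at this
    simpa [-aeval_eq_bind₁] using this
  have h1 := Ideal.mem_map_of_mem (aeval h : MvPolynomial σ ℂ →ₐ[ℂ] MvPolynomial τ ℂ) hf
  rw [Ideal.map_pow] at h1
  exact Ideal.pow_right_mono hle m h1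

theorem mul_mem_multAtLeast {m : ℕ} {v : σ → ℂ} (u : MvPolynomial σ ℂ) {f : MvPolynomial σ ℂ}
    (hf : f ∈ multAtLeast m v) : u * f ∈ multAtLeast m v :=
  Ideal.mul_mem_left _ u hf

/-- A factor that does not vanish at `v` does not contribute to the multiplicity there. -/
theorem mem_multAtLeast_of_mul {m : ℕ} {v : σ → ℂ} {u f : MvPolynomial σ ℂ} (hu : eval v u ≠ 0)
    (hf : u * f ∈ multAtLeast m v) : f ∈ multAtLeast m v := by
  set a := C (eval v u)⁻¹ * u with ha
  have h1 : 1 - a ∈ Ideal.span (Set.range fun i => (X i - C (v i) : MvPolynomial σ ℂ)) := by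
    rw [← neg_mem_iff]
    have := sub_C_eval_mem_span v a
    rwa [ha, map_mul, eval_C, inv_mul_cancel₀ hu, C_1, ← neg_sub] at this
  obtain ⟨b, hb⟩ := sub_dvd_pow_sub_pow 1 (1 - a) m
  rw [one_pow, sub_sub_cancel] at hb
  have h2 : f = f * (1 - a) ^ m + C (eval v u)⁻¹ * b * (u * f) := by
    linear_combination f * hb + ha * (b * f)
  rw [h2]
  exact add_mem (Ideal.mul_mem_left _ f (Ideal.pow_mem_pow h1 m)) (mul_mem_multAtLeast _ hf)

/-- Multiplicity at `v` in terms of the Taylor expansion at `v`. -/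
theorem mem_multAtLeast_iff {m : ℕ} {v : σ → ℂ} {f : MvPolynomial σ ℂ} :
    f ∈ multAtLeast m v ↔ ∀ α : {α : σ →₀ ℕ // α.degree < m},
      coeff α.1 (aeval (fun i => (X i + C (v i) : MvPolynomial σ ℂ)) f) = 0 := by
  have hzero : ∀ f : MvPolynomial σ ℂ, f ∈ multAtLeast m (0 : σ → ℂ) ↔
      ∀ α : {α : σ →₀ ℕ // α.degree < m}, coeff α.1 f = 0 := fun f => by
    rw [Subtype.forall, ← mem_pow_idealOfVars_iff']
    simp [multAtLeast, idealOfVars]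
  rw [← hzero]
  refine ⟨fun hf => aeval_mem_multAtLeast (fun i => by simp) hf, fun hf => ?_⟩
  have h1 : aeval (fun i => (X i - C (v i) : MvPolynomial σ ℂ))
      (aeval (fun i => (X i + C (v i) : MvPolynomial σ ℂ)) f) = f := by
    rw [← AlgHom.comp_apply]
    conv_rhs => rw [← AlgHom.id_apply (R := ℂ) f]
    congr 1
    ext i : 1
    simp [-aeval_eq_bind₁]
  rw [← h1]
  exact aeval_mem_multAtLeast (fun i => by simp) hf

end Multiplicity

/-! ### Semicontinuity of the dimension in algebraic families -/

section Semicontinuity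

variable {T σ M : Type} [AddCommGroup M] [Module ℂ M]

/-- A family of subspaces of `M`, parametrized by the points `t` with coordinates `c t`, is
algebraic if it is cut out by linear equations whose coefficients are polynomials in
the coordinates. -/
def IsAlgebraicFamily (c : T → σ → ℂ) (S : T → Submodule ℂ M) : Prop :=
  ∃ (ι : Type) (P : ι → M →ₗ[ℂ] MvPolynomial σ ℂ),
    ∀ t f, f ∈ S t ↔ ∀ i, eval (c t) (P i f) = 0

theorem IsAlgebraicFamily.const (c : T → σ → ℂ) (V : Submodule ℂ M) :
    IsAlgebraicFamily c fun _ => V := by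
  refine ⟨V.dualAnnihilator, fun φ => Algebra.linearMap ℂ _ ∘ₗ φ.1, fun t f => ?_⟩
  rw [← Subspace.forall_mem_dualAnnihilator_apply_eq_zero_iff]
  simp [Subtype.forall, algebraMap_eq]

theorem IsAlgebraicFamily.iInf {c : T → σ → ℂ} {κ : Type} {S : κ → T → Submodule ℂ M}
    (hS : ∀ k, IsAlgebraicFamily c (S k)) : IsAlgebraicFamily c fun t => ⨅ k, S k t := by
  choose ι P hP using hS
  refine ⟨Σ k, ι k, fun i => P i.1 i.2, fun t f => ?_⟩
  simp only [Submodule.mem_iInf, hP, Sigma.forall]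

theorem IsAlgebraicFamily.inf {c : T → σ → ℂ} {S S' : T → Submodule ℂ M}
    (hS : IsAlgebraicFamily c S) (hS' : IsAlgebraicFamily c S') :
    IsAlgebraicFamily c fun t => S t ⊓ S' t := by
  obtain ⟨ι, P, hP⟩ := hS
  obtain ⟨ι', P', hP'⟩ := hS'
  refine ⟨ι ⊕ ι', Sum.elim P P', fun t f => ?_⟩
  simp only [Submodule.mem_inf, hP, hP', Sum.forall, Sum.elim_inl, Sum.elim_inr]

theorem IsAlgebraicFamily.comap {M' : Type} [AddCommGroup M'] [Module ℂ M'] {c : T → σ → ℂ}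
    {S : T → Submodule ℂ M} (hS : IsAlgebraicFamily c S) (φ : M' →ₗ[ℂ] M) :
    IsAlgebraicFamily c fun t => (S t).comap φ := by
  obtain ⟨ι, P, hP⟩ := hS
  exact ⟨ι, fun i => P i ∘ₗ φ, fun t f => hP t (φ f)⟩

/-- The polynomials with multiplicity at least `m` at a point form an algebraic family: their
Taylor coefficients are polynomials in the coordinates of the point. -/
theorem isAlgebraicFamily_multAtLeast {τ : Type} (c : T → σ → ℂ) (m : ℕ) (k : τ → σ)
    {v : T → τ → ℂ} (hv : ∀ t i, v t i = c t (k i)) :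
    IsAlgebraicFamily c fun t => multAtLeast m (v t) := by
  refine ⟨{α : τ →₀ ℕ // α.degree < m},
    fun α => (lcoeff (MvPolynomial σ ℂ) α.1).restrictScalars ℂ ∘ₗ
      (aeval fun i => (X i + C (X (k i)) : MvPolynomial τ (MvPolynomial σ ℂ))).toLinearMap,
    fun t f => ?_⟩
  rw [mem_multAtLeast_iff]
  refine forall_congr' fun α => ?_
  have h1 : aeval (fun i => (X i + C (v t i) : MvPolynomial τ ℂ)) f =
      map (eval (c t)) (aeval (fun i => (X i + C (X (k i)) :
        MvPolynomial τ (MvPolynomial σ ℂ))) f) := by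
    induction f using MvPolynomial.induction_on with
    | C a => simp [algebraMap_eq, MvPolynomial.algebraMap_apply]
    | add p q hp hq => rw [map_add, map_add, map_add, hp, hq]
    | mul_X p i hp => rw [map_mul, map_mul, map_mul, hp]; simp [hv]
  rw [h1, coeff_map]
  rfl

/-- Linear forms without a common zero contain the dual of some basis. -/
theorem exists_basis_dual {Q : Type} [AddCommGroup Q] [Module ℂ Q] [FiniteDimensional ℂ Q]
    {ι : Type} (φ : ι → Module.Dual ℂ Q) (hφ : ∀ x, (∀ i, φ i x = 0) → x = 0) :
    ∃ (idx : Fin (Module.finrank ℂ Q) → ι) (q : Module.Basis (Fin (Module.finrank ℂ Q)) ℂ Q),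
      ∀ j k, φ (idx j) (q k) = (1 : Matrix _ _ ℂ) j k := by
  have hspan : Submodule.span ℂ (Set.range φ) = ⊤ := by
    have hbot : (Submodule.span ℂ (Set.range φ)).dualCoannihilator = ⊥ := by
      refine (Submodule.eq_bot_iff _).2 fun x hx => hφ x fun i => ?_
      exact (Submodule.mem_dualCoannihilator x).1 hx _ (Submodule.subset_span ⟨i, rfl⟩)
    rw [← Subspace.dualCoannihilator_dualAnnihilator_eq (W := Submodule.span ℂ (Set.range φ)),
      hbot, Submodule.dualAnnihilator_bot]
  obtain ⟨s, hs, hsspan, hli⟩ := exists_linearIndependent ℂ (Set.range φ)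
  rw [hspan] at hsspan
  let B₀ : Module.Basis s ℂ (Module.Dual ℂ Q) :=
    Module.Basis.mk hli (by rw [Subtype.range_coe, hsspan])
  have : Fintype s := FiniteDimensional.fintypeBasisIndex B₀
  have hcard : Fintype.card s = Module.finrank ℂ Q := by
    rw [← Module.finrank_eq_card_basis B₀, Subspace.dual_finrank_eq]
  let B := B₀.reindex (Fintype.equivFinOfCardEq hcard)
  have hB : ∀ j, ∃ i, φ i = B j := fun j => by
    simpa [B, B₀] using hs ((Fintype.equivFinOfCardEq hcard).symm j).2
  choose idx hidx using hB
  let L : Q →ₗ[ℂ] (Fin (Module.finrank ℂ Q) → ℂ) := LinearMap.pi B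
  have hLinj : Function.Injective L := by
    refine (injective_iff_map_eq_zero _).2 fun x hx => ?_
    refine (Module.forall_dual_apply_eq_zero_iff ℂ x).1 fun ψ => ?_
    rw [← B.sum_repr ψ, LinearMap.sum_apply]
    refine Finset.sum_eq_zero fun j _ => ?_
    rw [LinearMap.smul_apply, show B j x = 0 from congrFun hx j, smul_zero]
  let e := LinearEquiv.ofInjectiveOfFinrankEq L hLinj (by simp)
  refine ⟨idx, Module.Basis.ofEquivFun e, fun j k => ?_⟩
  have h1 : e (Module.Basis.ofEquivFun e k) = Pi.single k 1 := by simp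
  rw [hidx, show B j (Module.Basis.ofEquivFun e k) = e (Module.Basis.ofEquivFun e k) j from rfl, h1,
    Matrix.one_apply, Pi.single_apply]

/-- Upper semicontinuity: in an algebraic family of subspaces of a finite-dimensional space, the
dimension at `t₀` is not exceeded on a Zariski open neighbourhood of `t₀`. -/
theorem IsAlgebraicFamily.exists_finrank_le {c : T → σ → ℂ} {S : T → Submodule ℂ M}
    (hS : IsAlgebraicFamily c S) (V : Submodule ℂ M) [FiniteDimensional ℂ V]
    (hV : ∀ t, S t ≤ V) (t₀ : T) :
    ∃ g : MvPolynomial σ ℂ, eval (c t₀) g ≠ 0 ∧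
      ∀ t, eval (c t) g ≠ 0 → Module.finrank ℂ (S t) ≤ Module.finrank ℂ (S t₀) := by
  obtain ⟨ι, P, hP⟩ := hS
  obtain ⟨Q, hQ⟩ := Submodule.exists_isCompl ((S t₀).comap V.subtype)
  -- On a complement `Q` of `S t₀`, some of the equations at `t₀` form the dual of a basis, and
  -- `g` is the determinant of these equations on that basis.
  obtain ⟨idx, q, hq⟩ := exists_basis_dual
    (fun i => ((aeval (c t₀)).toLinearMap ∘ₗ P i ∘ₗ V.subtype ∘ₗ Q.subtype : Module.Dual ℂ Q))
    (fun x hx => by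
      have hmem : (x : V) ∈ (S t₀).comap V.subtype := (hP t₀ _).2 fun i => by
        simpa [aeval_eq_eval] using hx i
      exact Subtype.ext (Submodule.disjoint_def.1 hQ.disjoint x hmem x.2))
  let A : Matrix _ _ (MvPolynomial σ ℂ) := Matrix.of fun j k => P (idx j) (q k : V)
  have hdet : ∀ t, eval (c t) A.det = (A.map (eval (c t))).det := fun t =>
    RingHom.map_det _ _
  refine ⟨A.det, ?_, fun t ht => ?_⟩
  · have : A.map (eval (c t₀)) = 1 := by
      ext j k
      rw [← hq]
      simp [A, aeval_eq_eval]
    rw [hdet, this, Matrix.det_one]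
    exact one_ne_zero
  · rw [hdet] at ht
    have hdisj : Disjoint ((S t).comap V.subtype) Q := by
      rw [Submodule.disjoint_def]
      intro x hx hxQ
      let φ : Fin (Module.finrank ℂ Q) → Module.Dual ℂ Q := fun j =>
        (aeval (c t)).toLinearMap ∘ₗ P (idx j) ∘ₗ V.subtype ∘ₗ Q.subtype
      have hφ : ∀ j y, φ j y = eval (c t) (P (idx j) (y : V)) := fun j y => by
        simp [φ, aeval_eq_eval]
      have hz : (A.map (eval (c t))).mulVec (q.repr ⟨x, hxQ⟩) = 0 := by
        ext j
        have h1 : φ j ⟨x, hxQ⟩ = 0 := (hφ _ _).trans ((hP t x).1 hx (idx j))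
        rw [← q.sum_repr ⟨x, hxQ⟩, map_sum] at h1
        rw [Pi.zero_apply, ← h1, Matrix.mulVec, dotProduct]
        refine Finset.sum_congr rfl fun k _ => ?_
        rw [map_smul, hφ, smul_eq_mul, mul_comm]
        rfl
      have h0 : q.repr ⟨x, hxQ⟩ = 0 :=
        DFunLike.coe_injective (Matrix.eq_zero_of_mulVec_eq_zero ht hz)
      exact congrArg Subtype.val (q.repr.map_eq_zero_iff.1 h0)
    have h1 := Submodule.finrank_add_finrank_le_of_disjoint hdisj
    have h2 := Submodule.finrank_add_eq_of_isCompl hQ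
    have h3 : ∀ t, Module.finrank ℂ ↥((S t).comap V.subtype) = Module.finrank ℂ (S t) := fun t =>
      (Submodule.comapSubtypeEquivOfLe (hV t)).finrank_eq
    rw [h3] at h1 h2
    omega

end Semicontinuity

/-! ### General points -/

section GeneralPoints

variable {a b : ℕ} {Q Q' : (Fin (a + 1) → PlanePt) → (Fin b → RuledPt) → Prop}

/-- The homogeneous coordinates of all the points, as a vector. -/
def pointCoords (t : (Fin (a + 1) → PlanePt) × (Fin b → RuledPt)) :
    (Fin (a + 1) × Fin 3) ⊕ (Fin b × Fin 4) → ℂ :=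
  Sum.elim (fun i => (t.1 i.1).1 i.2) (fun j => (t.2 j.1).1 j.2)

theorem ForGeneralPoints.mono (h : ForGeneralPoints a b Q) (hQ : ∀ p q, Q p q → Q' p q) :
    ForGeneralPoints a b Q' := by
  obtain ⟨g, hg, h⟩ := h
  exact ⟨g, hg, fun p q hpq => hQ p q (h p q hpq)⟩

theorem ForGeneralPoints.and (h : ForGeneralPoints a b Q) (h' : ForGeneralPoints a b Q') :
    ForGeneralPoints a b fun p q => Q p q ∧ Q' p q := by
  obtain ⟨g, hg, h⟩ := h
  obtain ⟨g', hg', h'⟩ := h'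
  refine ⟨g * g', mul_ne_zero hg hg', fun p q hpq => ?_⟩
  rw [map_mul] at hpq
  exact ⟨h p q (left_ne_zero_of_mul hpq), h' p q (right_ne_zero_of_mul hpq)⟩

/-- General points have no vanishing homogeneous coordinate. -/
theorem forGeneralPoints_coords_ne_zero (a b : ℕ) : ForGeneralPoints a b fun p q =>
    (∀ i j, (p i).1 j ≠ 0) ∧ ∀ i j, (q i).1 j ≠ 0 := by
  refine ⟨∏ i, X i, Finset.prod_ne_zero_iff.2 fun i _ => X_ne_zero i, fun p q hpq => ?_⟩
  rw [map_prod, Finset.prod_ne_zero_iff] at hpq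
  exact ⟨fun i j => by simpa using hpq (Sum.inl (i, j)) (Finset.mem_univ _),
    fun i j => by simpa using hpq (Sum.inr (i, j)) (Finset.mem_univ _)⟩

/-- Vectors without vanishing coordinates are admissible as homogeneous coordinates, so that a
nonempty Zariski open set of coordinates contains those of actual points. -/
theorem ForGeneralPoints.exists (h : ForGeneralPoints a b Q) : ∃ p q, Q p q := by
  obtain ⟨g, hg, h⟩ := h
  have hne : g * ∏ i, X i ≠ 0 :=
    mul_ne_zero hg (Finset.prod_ne_zero_iff.2 fun i _ => X_ne_zero i)
  obtain ⟨u, hu⟩ : ∃ u, eval u (g * ∏ i, X i) ≠ 0 := by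
    by_contra! hall
    exact hne (MvPolynomial.funext fun u => by rw [hall u, map_zero])
  rw [map_mul, map_prod] at hu
  have hu' := fun i => Finset.prod_ne_zero_iff.1 (right_ne_zero_of_mul hu) i (Finset.mem_univ i)
  simp only [eval_X] at hu'
  refine ⟨fun i => ⟨fun j => u (Sum.inl (i, j)), fun h0 => hu' (Sum.inl (i, 0)) (congrFun h0 0)⟩,
    fun i => ⟨fun j => u (Sum.inr (i, j)), Or.inl (hu' _), Or.inl (hu' _)⟩, h _ _ ?_⟩
  have hcoord :
      (Sum.elim (fun i => u (Sum.inl (i.1, i.2))) fun j => u (Sum.inr (j.1, j.2))) = u := by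
    ext (i | i) <;> rfl
  have := left_ne_zero_of_mul hu
  rwa [← hcoord] at this

theorem IsAlgebraicFamily.forGeneralPoints_finrank_le {M : Type} [AddCommGroup M] [Module ℂ M]
    {S : (Fin (a + 1) → PlanePt) × (Fin b → RuledPt) → Submodule ℂ M}
    (hS : IsAlgebraicFamily pointCoords S) (V : Submodule ℂ M) [FiniteDimensional ℂ V]
    (hV : ∀ t, S t ≤ V) (t₀ : (Fin (a + 1) → PlanePt) × (Fin b → RuledPt)) :
    ForGeneralPoints a b fun p q =>
      Module.finrank ℂ (S (p, q)) ≤ Module.finrank ℂ (S t₀) := by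
  obtain ⟨g, hg, h⟩ := hS.exists_finrank_le V hV t₀
  exact ⟨g, fun h0 => hg (by rw [h0, map_zero]), fun p q hpq => h (p, q) hpq⟩

end GeneralPoints

/-! ### Forms on the plane and on the ruled surface -/

theorem mem_of_forall_support {σ M : Type*} [AddCommGroup M] [Module ℂ M]
    (φ : MvPolynomial σ ℂ →ₗ[ℂ] M) (N : Submodule ℂ M) (f : MvPolynomial σ ℂ)
    (h : ∀ α ∈ f.support, φ (monomial α 1) ∈ N) : φ f ∈ N := by
  have h1 := linearMap_eq_of_forall_support (N.mkQ ∘ₗ φ) 0 f fun α hα => by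
    simpa using h α hα
  simpa using h1

theorem mem_planeForms_iff {d : ℤ} {f : MvPolynomial (Fin 3) ℂ} :
    f ∈ planeForms d ↔ ∀ α ∈ f.support, (α 0 + α 1 + α 2 : ℤ) = d := by
  simp [planeForms, mem_weightedHomogeneousSubmodule, IsWeightedHomogeneous, Finsupp.weight_apply,
    Finsupp.sum_fintype, Fin.sum_univ_three]

theorem mem_ruledForms_iff {d e : ℤ} {f : MvPolynomial (Fin 4) ℂ} :
    f ∈ ruledForms d e ↔
      ∀ α ∈ f.support, (α 0 + α 1 + α 2 : ℤ) = d ∧ (α 0 + α 1 : ℤ) = α 3 + e := by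
  simp only [ruledForms, mem_weightedHomogeneousSubmodule, IsWeightedHomogeneous,
    Finsupp.weight_apply, Finsupp.sum_fintype, zero_smul, Fin.sum_univ_four, ruledClass,
    implies_true, mem_support_iff]
  refine forall₂_congr fun α _ => ?_
  simp [Prod.ext_iff]
  omega

instance finiteDimensional_planeForms (d : ℤ) : FiniteDimensional ℂ (planeForms d) := by
  refine Submodule.finiteDimensional_of_le (S₂ := restrictTotalDegree (Fin 3) ℂ d.toNat)
    fun f hf => ?_
  rw [mem_restrictTotalDegree]
  refine Finset.sup_le fun α hα => ?_
  have := mem_planeForms_iff.1 hf α hα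
  simp only [Finsupp.sum_fintype, Fin.sum_univ_three, implies_true]
  omega

instance finiteDimensional_ruledForms (d e : ℤ) : FiniteDimensional ℂ (ruledForms d e) := by
  refine Submodule.finiteDimensional_of_le
    (S₂ := restrictTotalDegree (Fin 4) ℂ (2 * d - e).toNat) fun f hf => ?_
  rw [mem_restrictTotalDegree]
  refine Finset.sup_le fun α hα => ?_
  have := mem_ruledForms_iff.1 hf α hα
  simp only [Finsupp.sum_fintype, Fin.sum_univ_four, implies_true]
  omega

theorem planeSystem_le (d : ℤ) (m₀ n m : ℕ) (p : Fin (n + 1) → PlanePt) :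
    planeSystem d m₀ n m p ≤ planeForms d :=
  inf_le_left.trans inf_le_left

theorem ruledSystem_le (d e : ℤ) (b m : ℕ) (q : Fin b → RuledPt) :
    ruledSystem d e b m q ≤ ruledForms d e :=
  inf_le_left

instance finiteDimensional_planeSystem (d : ℤ) (m₀ n m : ℕ) (p : Fin (n + 1) → PlanePt) :
    FiniteDimensional ℂ (planeSystem d m₀ n m p) :=
  Submodule.finiteDimensional_of_le (planeSystem_le d m₀ n m p)

instance finiteDimensional_ruledSystem (d e : ℤ) (b m : ℕ) (q : Fin b → RuledPt) :
    FiniteDimensional ℂ (ruledSystem d e b m q) :=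
  Submodule.finiteDimensional_of_le (ruledSystem_le d e b m q)

theorem mem_planeSystem_iff {d : ℤ} {m₀ n m : ℕ} {p : Fin (n + 1) → PlanePt}
    {f : MvPolynomial (Fin 3) ℂ} :
    f ∈ planeSystem d m₀ n m p ↔ f ∈ planeForms d ∧ f ∈ multAtLeast m₀ (p 0).1 ∧
      ∀ i : Fin n, f ∈ multAtLeast m (p i.succ).1 := by
  simp only [planeSystem, Submodule.mem_inf, Submodule.mem_iInf, and_assoc]

theorem mem_ruledSystem_iff {d e : ℤ} {b m : ℕ} {q : Fin b → RuledPt}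
    {f : MvPolynomial (Fin 4) ℂ} :
    f ∈ ruledSystem d e b m q ↔ f ∈ ruledForms d e ∧ ∀ i, f ∈ multAtLeast m (q i).1 := by
  simp only [ruledSystem, Submodule.mem_inf, Submodule.mem_iInf]

theorem restrictPlane_mem {e : ℕ} {f : MvPolynomial (Fin 3) ℂ} (hf : f ∈ planeForms e) :
    restrictPlane f ∈ homogeneousSubmodule (Fin 2) ℂ e := by
  refine mem_of_forall_support _ _ _ fun α hα => ?_
  have h1 := mem_planeForms_iff.1 hf α hα
  have h2 : restrictPlane (monomial α 1) = X 0 ^ α 0 * X 1 ^ α 1 * 0 ^ α 2 := by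
    simp [restrictPlane, aeval_monomial, Finsupp.prod_fintype, Fin.prod_univ_three,
      -aeval_eq_bind₁]
  rw [h2]
  by_cases h0 : α 2 = 0
  · rw [h0, pow_zero, mul_one, show e = α 0 + α 1 by omega]
    simpa using ((isHomogeneous_X ℂ (0 : Fin 2)).pow (α 0)).mul
      ((isHomogeneous_X ℂ (1 : Fin 2)).pow (α 1))
  · rw [zero_pow h0, mul_zero]
    exact Submodule.zero_mem _

theorem restrictRuled_mem {d : ℤ} {e : ℕ} {f : MvPolynomial (Fin 4) ℂ}
    (hf : f ∈ ruledForms d e) : restrictRuled f ∈ homogeneousSubmodule (Fin 2) ℂ e := by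
  refine mem_of_forall_support _ _ _ fun α hα => ?_
  have h1 := mem_ruledForms_iff.1 hf α hα
  have h2 : restrictRuled (monomial α 1) = X 0 ^ α 0 * X 1 ^ α 1 * 0 ^ α 3 := by
    simp [restrictRuled, aeval_monomial, Finsupp.prod_fintype, Fin.prod_univ_four,
      -aeval_eq_bind₁]
  rw [h2]
  by_cases h0 : α 3 = 0
  · rw [h0, pow_zero, mul_one, show e = α 0 + α 1 by omega]
    simpa using ((isHomogeneous_X ℂ (0 : Fin 2)).pow (α 0)).mul
      ((isHomogeneous_X ℂ (1 : Fin 2)).pow (α 1))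
  · rw [zero_pow h0, mul_zero]
    exact Submodule.zero_mem _

/-! ### The restriction sequences -/

/-- Setting `X i` to zero changes a polynomial by a multiple of `X i`. -/
theorem X_dvd_sub_aeval {σ : Type*} (i : σ) (h : σ → MvPolynomial σ ℂ) (hi : h i = 0)
    (hj : ∀ j ≠ i, h j = X j) (f : MvPolynomial σ ℂ) : X i ∣ f - aeval h f := by
  rw [← Ideal.mem_span_singleton, ← Ideal.Quotient.eq]
  have : Ideal.Quotient.mkₐ ℂ (Ideal.span {(X i : MvPolynomial σ ℂ)}) =
      (Ideal.Quotient.mkₐ ℂ _).comp (aeval h) := by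
    ext j : 1
    rw [AlgHom.comp_apply, aeval_X]
    by_cases hij : j = i
    · rw [hij, hi, map_zero]
      exact Ideal.Quotient.eq_zero_iff_mem.2 (Ideal.mem_span_singleton_self _)
    · rw [hj j hij]
  exact DFunLike.congr_fun this f

theorem X_dvd_of_restrictPlane_eq_zero {f : MvPolynomial (Fin 3) ℂ} (hf : restrictPlane f = 0) :
    X 2 ∣ f := by
  have h1 := X_dvd_sub_aeval (2 : Fin 3) ![X 0, X 1, 0] rfl
    (fun j hj => by fin_cases j <;> simp_all) f
  have h2 : (aeval ![X 0, X 1, 0] : MvPolynomial (Fin 3) ℂ →ₐ[ℂ] MvPolynomial (Fin 3) ℂ) =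
      (aeval ![X 0, X 1]).comp (aeval ![X 0, X 1, 0]) := by
    ext j : 1
    fin_cases j <;> simp
  have h3 : aeval ![X 0, X 1, 0] f = (0 : MvPolynomial (Fin 3) ℂ) := by
    rw [h2, AlgHom.comp_apply]
    exact (congrArg _ hf).trans (map_zero _)
  rwa [h3, sub_zero] at h1

/-- Homogeneity is needed here, since `restrictRuled` sets `z = 1`. -/
theorem X_dvd_of_restrictRuled_eq_zero {d e : ℤ} {f : MvPolynomial (Fin 4) ℂ}
    (hfd : f ∈ ruledForms d e) (hf : restrictRuled f = 0) : X 3 ∣ f := by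
  have h1 := X_dvd_sub_aeval (3 : Fin 4) ![X 0, X 1, X 2, 0] rfl
    (fun j hj => by fin_cases j <;> simp_all) f
  -- On `E` the exponent of `z` is determined by the class.
  have h3 := linearMap_eq_of_forall_support
    (aeval ![X 0, X 1, X 2, 0] : MvPolynomial (Fin 4) ℂ →ₐ[ℂ] MvPolynomial (Fin 4) ℂ).toLinearMap
    (LinearMap.mulLeft ℂ (X 2 ^ (d - e).toNat) ∘ₗ
      (aeval ![X 0, X 1] : MvPolynomial (Fin 2) ℂ →ₐ[ℂ] MvPolynomial (Fin 4) ℂ).toLinearMap ∘ₗ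
      restrictRuled) f fun α hα => by
    have h4 := mem_ruledForms_iff.1 hfd α hα
    by_cases h0 : α 3 = 0
    · simp [restrictRuled, aeval_monomial, Finsupp.prod_fintype, Fin.prod_univ_four, h0,
        show (d - e).toNat = α 2 by omega, -aeval_eq_bind₁]
      ring
    · simp [restrictRuled, aeval_monomial, Finsupp.prod_fintype, Fin.prod_univ_four, h0,
        -aeval_eq_bind₁]
  rw [LinearMap.comp_apply, LinearMap.comp_apply, hf, map_zero, map_zero,
    AlgHom.toLinearMap_apply] at h3
  rwa [h3, sub_zero] at h1

theorem finrank_eq_map_add_ker {M N : Type*} [AddCommGroup M] [Module ℂ M] [AddCommGroup N]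
    [Module ℂ N] (V : Submodule ℂ M) [FiniteDimensional ℂ V] (φ : M →ₗ[ℂ] N) :
    Module.finrank ℂ V = Module.finrank ℂ (V.map φ) +
      Module.finrank ℂ ↥(V ⊓ LinearMap.ker φ) := by
  rw [← (φ.domRestrict V).finrank_range_add_finrank_ker, LinearMap.range_domRestrict]
  congr 1
  rw [LinearMap.ker_domRestrict, ← Submodule.finrank_map_subtype_eq, Submodule.map_comap_subtype]

theorem support_X_mul_mem {σ : Type*} {i : σ} {g : MvPolynomial σ ℂ} {α : σ →₀ ℕ}
    (hα : α ∈ g.support) : α + Finsupp.single i 1 ∈ (X i * g).support := by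
  rw [mem_support_iff, add_comm, coeff_X_mul]
  exact mem_support_iff.1 hα

theorem exists_of_mem_support_X_mul {σ : Type*} {i : σ} {g : MvPolynomial σ ℂ} {α : σ →₀ ℕ}
    (hα : α ∈ (X i * g).support) : ∃ β ∈ g.support, α = β + Finsupp.single i 1 := by
  classical
  rw [support_X_mul, Finset.mem_map] at hα
  obtain ⟨β, hβ, rfl⟩ := hα
  exact ⟨β, hβ, add_comm _ _⟩

theorem finrank_mulLeft_X_map {σ : Type*} (i : σ) (V : Submodule ℂ (MvPolynomial σ ℂ)) :
    Module.finrank ℂ (V.map (LinearMap.mulLeft ℂ (X i))) = Module.finrank ℂ V :=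
  (Submodule.equivMapOfInjective _ (fun _ _ h => mul_left_cancel₀ (X_ne_zero i) h)
    V).finrank_eq.symm

/-- If no base point lies on `R`, the sections on the plane that vanish along `R` are `z` times the
sections of degree one less. -/
theorem finrank_planeSystem_eq (d : ℤ) (m₀ n m : ℕ) (p : Fin (n + 1) → PlanePt)
    (hp : ∀ i, (p i).1 2 ≠ 0) :
    Module.finrank ℂ (planeSystem d m₀ n m p) =
      Module.finrank ℂ ((planeSystem d m₀ n m p).map restrictPlane) +
        Module.finrank ℂ (planeSystem (d - 1) m₀ n m p) := by
  have hmem : ∀ g : MvPolynomial (Fin 3) ℂ,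
      X 2 * g ∈ planeSystem d m₀ n m p ↔ g ∈ planeSystem (d - 1) m₀ n m p := fun g => by
    have hmult : ∀ i k, X 2 * g ∈ multAtLeast k (p i).1 ↔ g ∈ multAtLeast k (p i).1 :=
      fun i k => ⟨mem_multAtLeast_of_mul (by rw [eval_X]; exact hp i), mul_mem_multAtLeast _⟩
    simp only [mem_planeSystem_iff, hmult, mem_planeForms_iff]
    refine and_congr_left fun _ => ⟨fun h α hα => ?_, fun h α hα => ?_⟩
    · have := h _ (support_X_mul_mem hα)
      simp at this
      omega
    · obtain ⟨β, hβ, rfl⟩ := exists_of_mem_support_X_mul hα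
      have := h β hβ
      simp
      omega
  have hker : planeSystem d m₀ n m p ⊓ LinearMap.ker restrictPlane =
      (planeSystem (d - 1) m₀ n m p).map (LinearMap.mulLeft ℂ (X 2)) := by
    ext f
    rw [Submodule.mem_inf, LinearMap.mem_ker, Submodule.mem_map]
    constructor
    · rintro ⟨hf, hf0⟩
      obtain ⟨g, rfl⟩ := X_dvd_of_restrictPlane_eq_zero hf0
      exact ⟨g, (hmem g).1 hf, rfl⟩
    · rintro ⟨g, hg, rfl⟩
      exact ⟨(hmem g).2 hg, by simp [restrictPlane]⟩
  rw [finrank_eq_map_add_ker _ restrictPlane, hker, finrank_mulLeft_X_map]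

/-- If no base point lies on `R`, the sections on the ruled surface that vanish along `R` are `s`
times the sections of the class less `E`. -/
theorem finrank_ruledSystem_eq (d e : ℤ) (b m : ℕ) (q : Fin b → RuledPt)
    (hq : ∀ i, (q i).1 3 ≠ 0) :
    Module.finrank ℂ (ruledSystem d e b m q) =
      Module.finrank ℂ ((ruledSystem d e b m q).map restrictRuled) +
        Module.finrank ℂ (ruledSystem d (e + 1) b m q) := by
  have hmem : ∀ g : MvPolynomial (Fin 4) ℂ,
      X 3 * g ∈ ruledSystem d e b m q ↔ g ∈ ruledSystem d (e + 1) b m q := fun g => by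
    have hmult : ∀ i k, X 3 * g ∈ multAtLeast k (q i).1 ↔ g ∈ multAtLeast k (q i).1 :=
      fun i k => ⟨mem_multAtLeast_of_mul (by rw [eval_X]; exact hq i), mul_mem_multAtLeast _⟩
    simp only [mem_ruledSystem_iff, hmult, mem_ruledForms_iff]
    refine and_congr_left fun _ => ⟨fun h α hα => ?_, fun h α hα => ?_⟩
    · have := h _ (support_X_mul_mem hα)
      simp at this
      omega
    · obtain ⟨β, hβ, rfl⟩ := exists_of_mem_support_X_mul hα
      have := h β hβ
      simp
      omega
  have hker : ruledSystem d e b m q ⊓ LinearMap.ker restrictRuled =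
      (ruledSystem d (e + 1) b m q).map (LinearMap.mulLeft ℂ (X 3)) := by
    ext f
    rw [Submodule.mem_inf, LinearMap.mem_ker, Submodule.mem_map]
    constructor
    · rintro ⟨hf, hf0⟩
      obtain ⟨g, rfl⟩ := X_dvd_of_restrictRuled_eq_zero (ruledSystem_le _ _ _ _ _ hf) hf0
      exact ⟨g, (hmem g).1 hf, rfl⟩
    · rintro ⟨g, hg, rfl⟩
      exact ⟨(hmem g).2 hg, by simp [restrictRuled]⟩
  rw [finrank_eq_map_add_ker _ restrictRuled, hker, finrank_mulLeft_X_map]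

/-- A product of subspaces, as a subspace of the product and as a product of vector spaces. -/
def prodSubmoduleEquiv {M N : Type*} [AddCommGroup M] [Module ℂ M] [AddCommGroup N] [Module ℂ N]
    (P : Submodule ℂ M) (F : Submodule ℂ N) : ↥(P.prod F) ≃ₗ[ℂ] P × F where
  toFun x := (⟨x.1.1, x.2.1⟩, ⟨x.1.2, x.2.2⟩)
  invFun x := ⟨(x.1.1, x.2.1), x.1.2, x.2.2⟩
  map_add' _ _ := rfl
  map_smul' _ _ := rfl

theorem finiteDimensional_prodSubmodule {M N : Type*} [AddCommGroup M] [Module ℂ M]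
    [AddCommGroup N] [Module ℂ N] (P : Submodule ℂ M) (F : Submodule ℂ N)
    [FiniteDimensional ℂ P] [FiniteDimensional ℂ F] : FiniteDimensional ℂ ↥(P.prod F) :=
  (prodSubmoduleEquiv P F).symm.finiteDimensional

/-- The dimension of a fibre product. -/
theorem finrank_prod_inf_eqLocus {M N S : Type*} [AddCommGroup M] [Module ℂ M] [AddCommGroup N]
    [Module ℂ N] [AddCommGroup S] [Module ℂ S] (P : Submodule ℂ M) (F : Submodule ℂ N)
    [FiniteDimensional ℂ P] [FiniteDimensional ℂ F] (φ : M →ₗ[ℂ] S) (ψ : N →ₗ[ℂ] S) :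
    Module.finrank ℂ ↥(P.prod F ⊓
        LinearMap.eqLocus (φ ∘ₗ LinearMap.fst ℂ M N) (ψ ∘ₗ LinearMap.snd ℂ M N)) +
      Module.finrank ℂ ↥(P.map φ ⊔ F.map ψ) = Module.finrank ℂ P + Module.finrank ℂ F := by
  let e := prodSubmoduleEquiv P F
  have := finiteDimensional_prodSubmodule P F
  have hmap : (P.prod F).map (φ ∘ₗ LinearMap.fst ℂ M N - ψ ∘ₗ LinearMap.snd ℂ M N) =
      P.map φ ⊔ F.map ψ := by
    ext x
    simp only [Submodule.mem_sup, Submodule.mem_map]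
    constructor
    · rintro ⟨⟨f, g⟩, ⟨hf, hg⟩, rfl⟩
      exact ⟨φ f, ⟨f, hf, rfl⟩, ψ (-g), ⟨-g, neg_mem hg, rfl⟩, by simp [sub_eq_add_neg]⟩
    · rintro ⟨_, ⟨f, hf, rfl⟩, _, ⟨g, hg, rfl⟩, rfl⟩
      exact ⟨(f, -g), ⟨hf, neg_mem hg⟩, by simp⟩
  rw [← Module.finrank_prod (M := P) (M' := F), ← e.finrank_eq,
    finrank_eq_map_add_ker (P.prod F) (φ ∘ₗ LinearMap.fst ℂ M N - ψ ∘ₗ LinearMap.snd ℂ M N),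
    ← LinearMap.eqLocus_eq_ker_sub, hmap, add_comm]

theorem finrank_limitSystem_add (d k : ℤ) (m₀ a b m : ℕ) (p : Fin (a + 1) → PlanePt)
    (q : Fin b → RuledPt) :
    Module.finrank ℂ (limitSystem d k m₀ a b m p q) +
      Module.finrank ℂ ↥((planeSystem (d - k) m₀ a m p).map restrictPlane ⊔
        (ruledSystem d (d - k) b m q).map restrictRuled) =
      Module.finrank ℂ (planeSystem (d - k) m₀ a m p) +
        Module.finrank ℂ (ruledSystem d (d - k) b m q) :=
  finrank_prod_inf_eqLocus _ _ _ _

/-! ### Changes of coordinates in the plane -/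

/-- The action of an invertible matrix on the points of the plane. -/
def PlanePt.act (A : Matrix (Fin 3) (Fin 3) ℂ) (hA : IsUnit A.det) (p : PlanePt) : PlanePt :=
  ⟨A.mulVec p.1, fun h => p.2 (Matrix.eq_zero_of_mulVec_eq_zero hA.ne_zero h)⟩

/-- Moving the base points by `A` amounts to substituting `A` in the forms. -/
theorem linSubst_mem_planeSystem_iff {d : ℤ} {m₀ n m : ℕ} {A : Matrix (Fin 3) (Fin 3) ℂ}
    (hA : IsUnit A.det) (p : Fin (n + 1) → PlanePt) (f : MvPolynomial (Fin 3) ℂ) :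
    linSubst A f ∈ planeSystem d m₀ n m p ↔
      f ∈ planeSystem d m₀ n m fun i => (p i).act A hA := by
  have hform : ∀ (B : Matrix (Fin 3) (Fin 3) ℂ) (g : MvPolynomial (Fin 3) ℂ),
      g ∈ planeForms d → linSubst B g ∈ planeForms d := fun B g hg => by
    refine mem_of_forall_support (linSubst B).toLinearMap _ _ fun α hα => ?_
    have h1 := mem_planeForms_iff.1 hg α hα
    have h2 : linSubst B (monomial α 1) ∈ homogeneousSubmodule (Fin 3) ℂ (α 0 + α 1 + α 2) := by
      refine linSubst_mem_homogeneousSubmodule B (isHomogeneous_monomial 1 ?_)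
      simp [Finsupp.degree_eq_sum, Fin.sum_univ_three]
    refine mem_planeForms_iff.2 fun β hβ => ?_
    have h3 := h2 (mem_support_iff.1 hβ)
    simp [Finsupp.weight_apply, Finsupp.sum_fintype, Fin.sum_univ_three] at h3
    omega
  have hmult : ∀ (B : Matrix (Fin 3) (Fin 3) ℂ) (k : ℕ) (v w : Fin 3 → ℂ)
      (g : MvPolynomial (Fin 3) ℂ), B.mulVec w = v → g ∈ multAtLeast k v →
      linSubst B g ∈ multAtLeast k w := fun B k v w g hv hg =>
    aeval_mem_multAtLeast (fun i => by rw [Matrix.toMvPolynomial_eval_eq_apply, hv]) hg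
  have hinv : ∀ i, A⁻¹.mulVec ((p i).act A hA).1 = (p i).1 := fun i => by
    rw [PlanePt.act, Matrix.mulVec_mulVec, Matrix.nonsing_inv_mul A hA, Matrix.one_mulVec]
  simp only [mem_planeSystem_iff]
  constructor
  · rintro ⟨h1, h2, h3⟩
    rw [← linSubst_inv hA f]
    exact ⟨hform _ _ h1, hmult _ _ _ _ _ (hinv _) h2, fun i => hmult _ _ _ _ _ (hinv _) (h3 i)⟩
  · rintro ⟨h1, h2, h3⟩
    exact ⟨hform _ _ h1, hmult _ _ _ _ _ rfl h2, fun i => hmult _ _ _ _ _ rfl (h3 i)⟩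

theorem planeSystem_eq_map_linSubst {d : ℤ} {m₀ n m : ℕ} {A : Matrix (Fin 3) (Fin 3) ℂ}
    (hA : IsUnit A.det) (p : Fin (n + 1) → PlanePt) :
    planeSystem d m₀ n m p =
      (planeSystem d m₀ n m fun i => (p i).act A hA).map (linSubst A).toLinearMap := by
  ext f
  constructor
  · intro hf
    have hAinv : linSubst A (linSubst A⁻¹ f) = f := by
      rw [linSubst_linSubst, Matrix.nonsing_inv_mul A hA, linSubst_one]
    refine ⟨linSubst A⁻¹ f, (linSubst_mem_planeSystem_iff hA p _).1 ?_, hAinv⟩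
    rwa [hAinv]
  · rintro ⟨g, hg, rfl⟩
    exact (linSubst_mem_planeSystem_iff hA p g).2 hg

theorem finrank_planeSystem_act {d : ℤ} {m₀ n m : ℕ} {A : Matrix (Fin 3) (Fin 3) ℂ}
    (hA : IsUnit A.det) (p : Fin (n + 1) → PlanePt) :
    Module.finrank ℂ (planeSystem d m₀ n m fun i => (p i).act A hA) =
      Module.finrank ℂ (planeSystem d m₀ n m p) := by
  rw [planeSystem_eq_map_linSubst hA p]
  exact (Submodule.equivMapOfInjective _ (linSubst_injective hA) _).finrank_eq

/-! ### Blowing down the ruled surface -/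

/-- The point `[0 : 0 : 1]`, to which the exceptional curve `E` is contracted. -/
def centerPt : PlanePt := ⟨![0, 0, 1], fun h => one_ne_zero (congrFun h 2)⟩

/-- The blow-down `(x, y, z, s) ↦ [xs : ys : z]`. -/
def RuledPt.blowDown (q : RuledPt) : PlanePt :=
  ⟨![q.1 0 * q.1 3, q.1 1 * q.1 3, q.1 2], fun h => by
    have h0 : q.1 0 * q.1 3 = 0 := congrFun h 0
    have h1 : q.1 1 * q.1 3 = 0 := congrFun h 1
    have h2 : q.1 2 = 0 := congrFun h 2
    have h3 : q.1 3 ≠ 0 := q.2.2.resolve_left (not_not.2 h2)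
    rcases q.2.1 with h | h
    · exact mul_ne_zero h h3 h0
    · exact mul_ne_zero h h3 h1⟩

/-- The forms with multiplicity at least `e` at `[0 : 0 : 1]` are those whose monomials have degree
at least `e` in `x, y`. -/
theorem le_add_of_mem_multAtLeast_centerPt {d : ℤ} {e : ℕ} {f : MvPolynomial (Fin 3) ℂ}
    (hf : f ∈ planeForms d) (hm : f ∈ multAtLeast e centerPt.1) {α : Fin 3 →₀ ℕ}
    (hα : α ∈ f.support) : e ≤ α 0 + α 1 := by
  by_contra! hlt
  have h1 : aeval ![X 0, X 1, 1] f ∈ multAtLeast e (0 : Fin 2 → ℂ) :=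
    aeval_mem_multAtLeast (fun i => by fin_cases i <;> simp [centerPt]) hm
  -- As `f` is homogeneous, its coefficients are those of `f(x, y, 1)`.
  let γ : (Fin 3 →₀ ℕ) → (Fin 2 →₀ ℕ) := fun β => Finsupp.equivFunOnFinite.symm ![β 0, β 1]
  have h2 : aeval ![X 0, X 1, 1] f ∈ idealOfVars (Fin 2) ℂ ^ e := by
    have : idealOfVars (Fin 2) ℂ =
        Ideal.span (Set.range fun i => (X i - C ((0 : Fin 2 → ℂ) i) : MvPolynomial (Fin 2) ℂ)) := by
      simp [idealOfVars]
    rw [this]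
    exact h1
  have h3 := (mem_pow_idealOfVars_iff' _ _).1 h2 (γ α) (by
    simpa [γ, Finsupp.degree_eq_sum, Fin.sum_univ_two] using hlt)
  have h4 : coeff (γ α) (aeval ![X 0, X 1, 1] f) = coeff α f := by
    refine linearMap_eq_of_forall_support
      (lcoeff ℂ (γ α) ∘ₗ (aeval ![X 0, X 1, 1] :
        MvPolynomial (Fin 3) ℂ →ₐ[ℂ] MvPolynomial (Fin 2) ℂ).toLinearMap)
      (lcoeff ℂ α) f fun β hβ => ?_
    have hα' := mem_planeForms_iff.1 hf α hα
    have hβ' := mem_planeForms_iff.1 hf β hβ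
    have h5 : aeval ![X 0, X 1, 1] (monomial β (1 : ℂ)) =
        (monomial (γ β) 1 : MvPolynomial (Fin 2) ℂ) := by
      rw [monomial_eq (s := γ β), aeval_monomial]
      simp [Finsupp.prod_fintype, Fin.prod_univ_three, Fin.prod_univ_two, γ]
    have h6 : γ β = γ α ↔ β = α := by
      rw [Finsupp.ext_iff, Finsupp.ext_iff, Fin.forall_fin_two, Fin.forall_fin_succ,
        Fin.forall_fin_two]
      simp only [γ, Finsupp.equivFunOnFinite_symm_apply_apply, Matrix.cons_val_zero,
        Matrix.cons_val_one, Fin.succ_zero_eq_one, Fin.succ_one_eq_two]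
      omega
    rw [LinearMap.comp_apply, AlgHom.toLinearMap_apply, h5]
    simp [coeff_monomial, h6]
  exact mem_support_iff.1 hα (h4.symm.trans h3)

/-- Setting `s = 1`: from sections on the ruled surface to forms on the plane. -/
def setSOne : MvPolynomial (Fin 4) ℂ →ₐ[ℂ] MvPolynomial (Fin 3) ℂ :=
  aeval ![X 0, X 1, X 2, 1]

/-- Pull-back along the blow-down. -/
def pullBack : MvPolynomial (Fin 3) ℂ →ₐ[ℂ] MvPolynomial (Fin 4) ℂ :=
  aeval ![X 0 * X 3, X 1 * X 3, X 2]

/-- Division of the pull-back by `s ^ e`, on monomials of degree at least `e` in `x, y`. -/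
def properTransform (e : ℕ) : MvPolynomial (Fin 3) ℂ →ₗ[ℂ] MvPolynomial (Fin 4) ℂ :=
  (basisMonomials (Fin 3) ℂ).constr ℂ fun α =>
    monomial (Finsupp.equivFunOnFinite.symm ![α 0, α 1, α 2, α 0 + α 1 - e]) 1

theorem properTransform_monomial (e : ℕ) (α : Fin 3 →₀ ℕ) :
    properTransform e (monomial α 1) =
      monomial (Finsupp.equivFunOnFinite.symm ![α 0, α 1, α 2, α 0 + α 1 - e]) 1 := by
  have := (basisMonomials (Fin 3) ℂ).constr_basis ℂ (fun α : Fin 3 →₀ ℕ =>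
    (monomial (Finsupp.equivFunOnFinite.symm ![α 0, α 1, α 2, α 0 + α 1 - e]) 1 :
      MvPolynomial (Fin 4) ℂ)) α
  rwa [coe_basisMonomials] at this

theorem setSOne_monomial (α : Fin 4 →₀ ℕ) :
    setSOne (monomial α 1) = X 0 ^ α 0 * X 1 ^ α 1 * X 2 ^ α 2 := by
  simp [setSOne, aeval_monomial, Finsupp.prod_fintype, Fin.prod_univ_four, -aeval_eq_bind₁]

theorem setSOne_properTransform (e : ℕ) (f : MvPolynomial (Fin 3) ℂ) :
    setSOne (properTransform e f) = f := by
  refine linearMap_eq_of_forall_support (setSOne.toLinearMap ∘ₗ properTransform e) LinearMap.id f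
    fun α _ => ?_
  rw [LinearMap.comp_apply, properTransform_monomial, AlgHom.toLinearMap_apply, setSOne_monomial,
    LinearMap.id_apply, monomial_eq]
  simp [Finsupp.prod_fintype, Fin.prod_univ_three]

theorem pullBack_setSOne {d : ℤ} {e : ℕ} {g : MvPolynomial (Fin 4) ℂ} (hg : g ∈ ruledForms d e) :
    pullBack (setSOne g) = X 3 ^ e * g := by
  refine linearMap_eq_of_forall_support (pullBack.toLinearMap ∘ₗ setSOne.toLinearMap)
    (LinearMap.mulLeft ℂ (X 3 ^ e)) g fun α hα => ?_
  have h := mem_ruledForms_iff.1 hg α hα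
  have h3 : α 0 + α 1 = e + α 3 := by omega
  have h4 : (X 3 : MvPolynomial (Fin 4) ℂ) ^ α 0 * X 3 ^ α 1 = X 3 ^ e * X 3 ^ α 3 := by
    rw [← pow_add, ← pow_add, h3]
  rw [LinearMap.comp_apply, AlgHom.toLinearMap_apply, AlgHom.toLinearMap_apply, setSOne_monomial,
    LinearMap.mulLeft_apply, monomial_eq]
  simp only [pullBack, map_mul, map_pow, aeval_X, Finsupp.prod_fintype, Fin.prod_univ_four,
    pow_zero, implies_true, C_1, one_mul, Matrix.cons_val_zero, Matrix.cons_val_one,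
    Matrix.cons_val, mul_pow]
  linear_combination (X 0 ^ α 0 * X 1 ^ α 1 * X 2 ^ α 2) * h4

/-- Away from `E`, the multiplicity of a section at a point of the ruled surface is that of the
corresponding form at the image of the point. -/
theorem setSOne_mem_multAtLeast_iff {d : ℤ} {e m : ℕ} {g : MvPolynomial (Fin 4) ℂ}
    (hg : g ∈ ruledForms d e) (q : RuledPt) (hq : q.1 3 ≠ 0) :
    setSOne g ∈ multAtLeast m q.blowDown.1 ↔ g ∈ multAtLeast m q.1 := by
  constructor
  · intro h
    refine mem_multAtLeast_of_mul (u := X 3 ^ e) (by simpa using pow_ne_zero e hq) ?_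
    rw [← pullBack_setSOne hg]
    exact aeval_mem_multAtLeast (fun i => by fin_cases i <;> simp [RuledPt.blowDown]) h
  · intro h
    set s := q.1 3 with hs
    -- The map `(x, y, z) ↦ (x / s, y / s, z, s)` takes the image of `q` back to `q`.
    have h1 : aeval ![C s⁻¹ * X 0, C s⁻¹ * X 1, X 2, C s] g ∈ multAtLeast m q.blowDown.1 := by
      refine aeval_mem_multAtLeast (fun i => ?_) h
      fin_cases i <;> simp [RuledPt.blowDown, ← hs, hq, mul_comm]
    have h2 : setSOne g =
        C (s ^ e) * aeval ![C s⁻¹ * X 0, C s⁻¹ * X 1, X 2, C s] g := by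
      refine linearMap_eq_of_forall_support setSOne.toLinearMap
        (LinearMap.mulLeft ℂ (C (s ^ e)) ∘ₗ
          (aeval ![C s⁻¹ * X 0, C s⁻¹ * X 1, X 2, C s] :
            MvPolynomial (Fin 4) ℂ →ₐ[ℂ] MvPolynomial (Fin 3) ℂ).toLinearMap) g fun α hα => ?_
      have h := mem_ruledForms_iff.1 hg α hα
      have h3 : α 0 + α 1 = e + α 3 := by omega
      have h4 : s ^ e * (s⁻¹ ^ α 0 * s⁻¹ ^ α 1 * s ^ α 3) = 1 := by
        rw [← pow_add, h3, pow_add, inv_pow, inv_pow]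
        field_simp
      have h5 := congrArg (C : ℂ → MvPolynomial (Fin 3) ℂ) h4
      rw [AlgHom.toLinearMap_apply, setSOne_monomial, LinearMap.comp_apply,
        AlgHom.toLinearMap_apply, LinearMap.mulLeft_apply, monomial_eq]
      simp only [map_mul, map_pow, aeval_X, Finsupp.prod_fintype, Fin.prod_univ_four,
        pow_zero, implies_true, C_1, one_mul, Matrix.cons_val_zero, Matrix.cons_val_one,
        Matrix.cons_val, mul_pow] at h5 ⊢
      linear_combination -(X 0 ^ α 0 * X 1 ^ α 1 * X 2 ^ α 2) * h5
    rw [h2]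
    exact mul_mem_multAtLeast _ h1

theorem setSOne_mem_multAtLeast_centerPt {d : ℤ} {e : ℕ} {g : MvPolynomial (Fin 4) ℂ}
    (hg : g ∈ ruledForms d e) : setSOne g ∈ multAtLeast e centerPt.1 := by
  refine mem_of_forall_support setSOne.toLinearMap _ _ fun α hα => ?_
  have h := mem_ruledForms_iff.1 hg α hα
  rw [AlgHom.toLinearMap_apply, setSOne_monomial]
  set I := Ideal.span (Set.range fun i => (X i - C (centerPt.1 i) : MvPolynomial (Fin 3) ℂ))
  have h0 : (X 0 : MvPolynomial (Fin 3) ℂ) ∈ I := Ideal.subset_span ⟨0, by simp [centerPt]⟩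
  have h1 : (X 1 : MvPolynomial (Fin 3) ℂ) ∈ I := Ideal.subset_span ⟨1, by simp [centerPt]⟩
  have h2 := Ideal.mul_mem_mul (Ideal.pow_mem_pow h0 (α 0)) (Ideal.pow_mem_pow h1 (α 1))
  rw [← pow_add] at h2
  exact Ideal.mul_mem_right _ _ (Ideal.pow_le_pow_right (by omega) h2)

/-- Sections of `𝒪(d H - e E)` with given multiplicities at points off `E` correspond to plane forms
of degree `d` with multiplicity at least `e` at `[0 : 0 : 1]` and the given multiplicities at the
images of the points. -/
theorem finrank_ruledSystem_eq_planeSystem (d : ℤ) (e b m : ℕ) (q : Fin b → RuledPt)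
    (hq : ∀ i, (q i).1 3 ≠ 0) :
    Module.finrank ℂ (ruledSystem d e b m q) = Module.finrank ℂ
      (planeSystem d e b m (Fin.cons centerPt fun i => (q i).blowDown)) := by
  have hinj : Function.Injective (setSOne.toLinearMap.domRestrict (ruledSystem d e b m q)) := by
    refine (injective_iff_map_eq_zero _).2 fun g hg => Subtype.ext ?_
    have h1 := pullBack_setSOne (ruledSystem_le _ _ _ _ _ g.2)
    rw [show setSOne g.1 = 0 from hg, map_zero] at h1
    exact (mul_eq_zero.1 h1.symm).resolve_left (pow_ne_zero _ (X_ne_zero _))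
  rw [← LinearMap.finrank_range_of_inj hinj, LinearMap.range_domRestrict]
  have hmap : (ruledSystem d e b m q).map setSOne.toLinearMap =
      planeSystem d e b m (Fin.cons centerPt fun i => (q i).blowDown) := by
    ext f
    simp only [Submodule.mem_map, mem_planeSystem_iff, mem_ruledSystem_iff, Fin.cons_zero,
      Fin.cons_succ, AlgHom.toLinearMap_apply]
    constructor
    · rintro ⟨g, ⟨hg, hgm⟩, rfl⟩
      refine ⟨mem_of_forall_support setSOne.toLinearMap _ _ fun α hα => ?_,
        setSOne_mem_multAtLeast_centerPt hg,
        fun i => (setSOne_mem_multAtLeast_iff hg _ (hq i)).2 (hgm i)⟩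
      have h := mem_ruledForms_iff.1 hg α hα
      rw [AlgHom.toLinearMap_apply, setSOne_monomial]
      have h1 : (X 0 ^ α 0 * X 1 ^ α 1 * X 2 ^ α 2 : MvPolynomial (Fin 3) ℂ) ∈
          weightedHomogeneousSubmodule ℂ (fun _ => (1 : ℤ)) (α 0 • 1 + α 1 • 1 + α 2 • 1) :=
        (((isWeightedHomogeneous_X ℂ _ 0).pow _).mul ((isWeightedHomogeneous_X ℂ _ 1).pow _)).mul
          ((isWeightedHomogeneous_X ℂ _ 2).pow _)
      rwa [show (α 0 • 1 + α 1 • 1 + α 2 • 1 : ℤ) = d by simpa using h.1] at h1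
    · rintro ⟨hf, hf0, hfm⟩
      have hg : properTransform e f ∈ ruledForms d e := by
        refine mem_of_forall_support _ _ _ fun α hα => ?_
        have h1 := mem_planeForms_iff.1 hf α hα
        have h2 := le_add_of_mem_multAtLeast_centerPt hf hf0 hα
        rw [properTransform_monomial]
        refine mem_ruledForms_iff.2 fun β hβ => ?_
        have hβ' := Finset.mem_singleton.1 (support_monomial_subset hβ)
        subst hβ'
        simp
        omega
      refine ⟨properTransform e f, ⟨hg, fun i => ?_⟩, setSOne_properTransform e f⟩
      rw [← setSOne_mem_multAtLeast_iff hg _ (hq i), setSOne_properTransform]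
      exact hfm i
  rw [hmap]

/-! ### Dimensions for general points -/

/-- The least dimension of the vector spaces `planeSystem d m₀ n m p`. -/
def minFinrank (d : ℤ) (m₀ n m : ℕ) : ℕ :=
  ⨅ p : Fin (n + 1) → PlanePt, Module.finrank ℂ (planeSystem d m₀ n m p)

theorem ell_eq (d : ℤ) (m₀ n m : ℕ) : ell d m₀ n m = minFinrank d m₀ n m - 1 := rfl

theorem minFinrank_le (d : ℤ) (m₀ n m : ℕ) (p : Fin (n + 1) → PlanePt) :
    minFinrank d m₀ n m ≤ Module.finrank ℂ (planeSystem d m₀ n m p) :=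
  ciInf_le (OrderBot.bddBelow _) p

theorem exists_finrank_eq_minFinrank (d : ℤ) (m₀ n m : ℕ) :
    ∃ p, Module.finrank ℂ (planeSystem d m₀ n m p) = minFinrank d m₀ n m := by
  have : Nonempty PlanePt := ⟨centerPt⟩
  exact Nat.sInf_mem (Set.range_nonempty _)

theorem isAlgebraicFamily_planeSystem (d : ℤ) (m₀ a b m : ℕ) :
    IsAlgebraicFamily (pointCoords (a := a) (b := b)) fun t => planeSystem d m₀ a m t.1 :=
  ((IsAlgebraicFamily.const _ _).inf
    (isAlgebraicFamily_multAtLeast _ m₀ (fun j => Sum.inl (0, j)) fun _ _ => rfl)).inf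
    (IsAlgebraicFamily.iInf fun i : Fin a =>
      isAlgebraicFamily_multAtLeast _ m (fun j => Sum.inl (i.succ, j)) fun _ _ => rfl)

theorem isAlgebraicFamily_ruledSystem (d e : ℤ) (a b m : ℕ) :
    IsAlgebraicFamily (pointCoords (a := a) (b := b)) fun t => ruledSystem d e b m t.2 :=
  (IsAlgebraicFamily.const _ _).inf
    (IsAlgebraicFamily.iInf fun i : Fin b =>
      isAlgebraicFamily_multAtLeast _ m (fun j => Sum.inr (i, j)) fun _ _ => rfl)

theorem isAlgebraicFamily_limitSystem (d k : ℤ) (m₀ a b m : ℕ) :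
    IsAlgebraicFamily (pointCoords (a := a) (b := b))
      fun t => limitSystem d k m₀ a b m t.1 t.2 := by
  have h := (((isAlgebraicFamily_planeSystem (d - k) m₀ a b m).comap
    (LinearMap.fst ℂ (MvPolynomial (Fin 3) ℂ) (MvPolynomial (Fin 4) ℂ))).inf
    ((isAlgebraicFamily_ruledSystem d (d - k) a b m).comap
      (LinearMap.snd ℂ (MvPolynomial (Fin 3) ℂ) (MvPolynomial (Fin 4) ℂ)))).inf
    (IsAlgebraicFamily.const _ (LinearMap.eqLocus
      (restrictPlane ∘ₗ LinearMap.fst ℂ (MvPolynomial (Fin 3) ℂ) (MvPolynomial (Fin 4) ℂ))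
      (restrictRuled ∘ₗ LinearMap.snd ℂ (MvPolynomial (Fin 3) ℂ) (MvPolynomial (Fin 4) ℂ))))
  obtain ⟨ι, P, hP⟩ := h
  exact ⟨ι, P, fun t f => Iff.trans Iff.rfl (hP t f)⟩

instance (b : ℕ) : Nonempty (Fin b → RuledPt) :=
  ⟨fun _ => ⟨fun _ => 1, Or.inl one_ne_zero, Or.inl one_ne_zero⟩⟩

theorem forGeneralPoints_finrank_planeSystem (d : ℤ) (m₀ a b m : ℕ) :
    ForGeneralPoints a b fun p _ =>
      Module.finrank ℂ (planeSystem d m₀ a m p) = minFinrank d m₀ a m := by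
  obtain ⟨p₀, hp₀⟩ := exists_finrank_eq_minFinrank d m₀ a m
  refine ((isAlgebraicFamily_planeSystem d m₀ a b m).forGeneralPoints_finrank_le (planeForms d)
    (fun t => planeSystem_le _ _ _ _ _) (p₀, Classical.arbitrary _)).mono fun p _ h => ?_
  exact le_antisymm (h.trans hp₀.le) (minFinrank_le _ _ _ _ _)

/-- For general points of the plane, no other point lies on the line that joins the first one with
`[0 : 1 : 0]`. -/
theorem forGeneralPoints_not_aligned (b : ℕ) : ForGeneralPoints b 0 fun p _ =>
    ∀ i : Fin b, (p i.succ).1 0 * (p 0).1 2 - (p 0).1 0 * (p i.succ).1 2 ≠ 0 := by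
  refine ⟨∏ i : Fin b, (X (Sum.inl (i.succ, 0)) * X (Sum.inl (0, 2)) -
    X (Sum.inl (0, 0)) * X (Sum.inl (i.succ, 2))),
    Finset.prod_ne_zero_iff.2 fun i _ h => ?_, fun p q hpq i => ?_⟩
  · have := congrArg (eval (Sum.elim (fun j => if j.2 = 0 ∧ j.1 = 0 then 0 else 1) 0)) h
    simp at this
  · rw [map_prod, Finset.prod_ne_zero_iff] at hpq
    simpa using hpq i (Finset.mem_univ i)

/-- The minimal dimension of the plane systems is attained by points of which the first is
`[0 : 0 : 1]` and the others are images of points of the ruled surface off `E`. -/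
theorem exists_finrank_ruledSystem_eq (d : ℤ) (e b m : ℕ) :
    ∃ q, Module.finrank ℂ (ruledSystem d e b m q) = minFinrank d e b m := by
  -- There are no points on the ruled surface here: only plane points have to be general.
  obtain ⟨p, _, hfin, hne, hal⟩ := ((forGeneralPoints_finrank_planeSystem d e b 0 m).and
    ((forGeneralPoints_coords_ne_zero b 0).and (forGeneralPoints_not_aligned b))).exists
  have hz := hne.1 0 2
  set u := (p 0).1 0 with hu
  set v := (p 0).1 1 with hv
  set z := (p 0).1 2 with hzdef
  -- The matrix `A` takes the first point to `[0 : 0 : 1]`.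
  let A : Matrix (Fin 3) (Fin 3) ℂ := !![1, 0, -u / z; 0, 1, -v / z; 0, 0, 1 / z]
  have hA : IsUnit A.det := by
    simp [A, Matrix.det_fin_three, hz]
  let q : Fin b → RuledPt := fun i =>
    ⟨![(p i.succ).1 0 - u / z * (p i.succ).1 2, (p i.succ).1 1 - v / z * (p i.succ).1 2,
      (p i.succ).1 2 / z, 1], by
        refine ⟨Or.inl fun h => hal i ?_, Or.inr one_ne_zero⟩
        have h' : (p i.succ).1 0 - u / z * (p i.succ).1 2 = 0 := h
        field_simp at h'
        linear_combination h'⟩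
  refine ⟨q, ?_⟩
  have hpts : (Fin.cons centerPt fun i => (q i).blowDown : Fin (b + 1) → PlanePt) =
      fun i => (p i).act A hA := by
    funext i
    refine Subtype.ext ?_
    cases i using Fin.cases with
    | zero =>
      ext j
      fin_cases j <;>
        simp [PlanePt.act, centerPt, A, dotProduct, Fin.sum_univ_three, ← hu, ← hv,
          ← hzdef, hz]
    | succ i =>
      ext j
      fin_cases j <;>
        simp [PlanePt.act, RuledPt.blowDown, q, A, dotProduct, Fin.sum_univ_three] <;>
        ring
  rw [finrank_ruledSystem_eq_planeSystem d e b m q fun i => one_ne_zero, hpts,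
    finrank_planeSystem_act hA p, hfin]

theorem forGeneralPoints_finrank_ruledSystem (d : ℤ) (e a b m : ℕ) :
    ForGeneralPoints a b fun _ q =>
      Module.finrank ℂ (ruledSystem d e b m q) = minFinrank d e b m := by
  obtain ⟨q₀, hq₀⟩ := exists_finrank_ruledSystem_eq d e b m
  refine (((isAlgebraicFamily_ruledSystem d e a b m).forGeneralPoints_finrank_le (ruledForms d e)
    (fun t => ruledSystem_le _ _ _ _ _) (fun _ => centerPt, q₀)).and
    (forGeneralPoints_coords_ne_zero a b)).mono fun p q h => ?_
  refine le_antisymm (h.1.trans hq₀.le) ?_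
  rw [finrank_ruledSystem_eq_planeSystem d e b m q fun i => h.2.2 i 3]
  exact minFinrank_le _ _ _ _ _

/-! ### General position of the two restricted systems -/

/-- An invertible change of the coordinates `x, y` of the plane acts on restrictions to `R` as a
change of coordinates of binary forms. -/
theorem exists_map_restrictPlane_eq {A : Matrix (Fin 2) (Fin 2) ℂ} (hA : IsUnit A.det) (d : ℤ)
    (m₀ a m : ℕ) (p : Fin (a + 1) → PlanePt) :
    ∃ p', Module.finrank ℂ (planeSystem d m₀ a m p') = Module.finrank ℂ (planeSystem d m₀ a m p) ∧
      (planeSystem d m₀ a m p').map restrictPlane =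
        ((planeSystem d m₀ a m p).map restrictPlane).map (linSubst A).toLinearMap := by
  let B : Matrix (Fin 3) (Fin 3) ℂ := !![A 0 0, A 0 1, 0; A 1 0, A 1 1, 0; 0, 0, 1]
  have hB : IsUnit B.det := by
    have : B.det = A.det := by
      simp [B, Matrix.det_fin_three, Matrix.det_fin_two]
    rwa [this]
  have hBinv := Matrix.isUnit_nonsing_inv_det B hB
  let p' : Fin (a + 1) → PlanePt := fun i => (p i).act B⁻¹ hBinv
  have hp' : (fun i => (p' i).act B hB) = p := by
    funext i
    refine Subtype.ext ?_
    simp only [p', PlanePt.act, Matrix.mulVec_mulVec]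
    rw [Matrix.mul_nonsing_inv B hB, Matrix.one_mulVec]
  refine ⟨p', finrank_planeSystem_act hBinv p, ?_⟩
  have hcomm : restrictPlane ∘ₗ (linSubst B).toLinearMap =
      (linSubst A).toLinearMap ∘ₗ restrictPlane := by
    have : (aeval ![X 0, X 1, 0] : MvPolynomial (Fin 3) ℂ →ₐ[ℂ] MvPolynomial (Fin 2) ℂ).comp
        (linSubst B) = (linSubst A).comp (aeval ![X 0, X 1, 0]) := by
      ext j : 1
      rw [AlgHom.comp_apply, AlgHom.comp_apply, linSubst, linSubst, aeval_X, aeval_X]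
      fin_cases j <;>
        simp [Matrix.toMvPolynomial, Fin.sum_univ_three, B, ← C_mul_X_eq_monomial]
    exact congrArg AlgHom.toLinearMap this
  rw [planeSystem_eq_map_linSubst hB p', hp', ← Submodule.map_comp, hcomm, Submodule.map_comp]

/-- For general points, the restrictions to `R` of the systems on the two components are transversal:
they span a space of binary forms of degree `D` of the dimension that the `min` in the statement
gives. This determines the dimension of the limit system, which is their fibre product. -/
theorem forGeneralPoints_finrank_limitSystem (d k : ℤ) (D m₀ a b m : ℕ) (hD : (D : ℤ) = d - k) :
    ForGeneralPoints a b fun p q =>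
      Module.finrank ℂ (limitSystem d k m₀ a b m p q) +
        min (minFinrank (d - k) m₀ a m - minFinrank (d - k - 1) m₀ a m +
          (minFinrank d D b m - minFinrank d (D + 1) b m)) (D + 1) =
      minFinrank (d - k) m₀ a m + minFinrank d D b m ∧
      minFinrank (d - k - 1) m₀ a m ≤ minFinrank (d - k) m₀ a m ∧
      minFinrank d (D + 1) b m ≤ minFinrank d D b m := by
  have hgen := (forGeneralPoints_coords_ne_zero a b).and
    (((forGeneralPoints_finrank_planeSystem (d - k) m₀ a b m).and
      (forGeneralPoints_finrank_planeSystem (d - k - 1) m₀ a b m)).and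
    ((forGeneralPoints_finrank_ruledSystem d D a b m).and
      (forGeneralPoints_finrank_ruledSystem d (D + 1) a b m)))
  obtain ⟨p₀, q₀, ⟨hp₀, hq₀⟩, ⟨hP, hP'⟩, hF, hF'⟩ := hgen.exists
  have hVP : ∀ p, (planeSystem (d - k) m₀ a m p).map restrictPlane ≤
      homogeneousSubmodule (Fin 2) ℂ D := fun p => by
    rintro _ ⟨f, hf, rfl⟩
    exact restrictPlane_mem (hD ▸ planeSystem_le _ _ _ _ _ hf)
  have hVF : ∀ q, (ruledSystem d (d - k) b m q).map restrictRuled ≤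
      homogeneousSubmodule (Fin 2) ℂ D := fun q => by
    rintro _ ⟨f, hf, rfl⟩
    exact restrictRuled_mem (hD ▸ ruledSystem_le _ _ _ _ _ hf)
  have hrP := finrank_planeSystem_eq (d - k) m₀ a m p₀ fun i => hp₀ i 2
  have hrF := finrank_ruledSystem_eq d D b m q₀ fun i => hq₀ i 3
  push_cast at hF'
  rw [hP, hP'] at hrP
  rw [hF, hF', hD] at hrF
  rw [hD] at hF
  -- At some points the restrictions are transversal.
  obtain ⟨A, hA, htrans⟩ := exists_linSubst_transversal (hVF q₀) (hVP p₀)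
  obtain ⟨p₁, hp₁, hmap⟩ := exists_map_restrictPlane_eq hA (d - k) m₀ a m p₀
  have hlim := finrank_limitSystem_add d k m₀ a b m p₁ q₀
  rw [hmap, sup_comm, hp₁, hP, hF] at hlim
  have := finiteDimensional_prodSubmodule (planeForms (d - k)) (ruledForms d (d - k))
  have hle := (isAlgebraicFamily_limitSystem d k m₀ a b m).forGeneralPoints_finrank_le
    ((planeForms (d - k)).prod (ruledForms d (d - k)))
    (fun t => inf_le_left.trans (Submodule.prod_mono (planeSystem_le _ _ _ _ _)
      (ruledSystem_le _ _ _ _ _))) (p₁, q₀)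
  refine (hle.and hgen).mono fun p q h => ?_
  obtain ⟨hle, ⟨hp, hq⟩, ⟨hPp, hPp'⟩, hFq, hFq'⟩ := h
  have hlim' := finrank_limitSystem_add d k m₀ a b m p q
  have hrP' := finrank_planeSystem_eq (d - k) m₀ a m p fun i => hp i 2
  have hrF' := finrank_ruledSystem_eq d D b m q fun i => hq i 3
  push_cast at hFq'
  rw [hPp, hPp'] at hrP'
  rw [hFq, hFq', hD] at hrF'
  rw [hD] at hFq
  rw [hPp, hFq] at hlim'
  have hsup := finrank_le_of_le_homogeneousSubmodule (sup_le (hVP p) (hVF q))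
  have hsum := Submodule.finrank_add_le_finrank_add_finrank
    ((planeSystem (d - k) m₀ a m p).map restrictPlane)
    ((ruledSystem d (d - k) b m q).map restrictRuled)
  dsimp only at hle
  omega

end

end PlaneDegeneration

theorem mainTheorem3 (d : ℕ) (k : ℤ) (m₀ n b m : ℕ) (hk : k ≤ d) (hb : b ≤ n) :
    PlaneDegeneration.ForGeneralPoints (n - b) b fun p q =>
      (PlaneDegeneration.rP d k m₀ n b m + PlaneDegeneration.rF d k b m ≤ d - k - 1 →
        PlaneDegeneration.limitDim d k m₀ (n - b) b m p q =
          PlaneDegeneration.ellHatP d k m₀ n b m + PlaneDegeneration.ellHatF d k b m + 1) ∧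
      (d - k - 1 ≤ PlaneDegeneration.rP d k m₀ n b m + PlaneDegeneration.rF d k b m →
        PlaneDegeneration.limitDim d k m₀ (n - b) b m p q =
          PlaneDegeneration.ellP d k m₀ n b m + PlaneDegeneration.ellF d k b m - d + k) := by
  have hD : ((d - k).toNat : ℤ) = d - k := Int.toNat_of_nonneg (by omega)
  have hD' : (d - k + 1).toNat = (d - k).toNat + 1 := by omega
  refine (PlaneDegeneration.forGeneralPoints_finrank_limitSystem d k _ m₀ (n - b) b m hD).mono
    fun p q h => ?_
  simp only [PlaneDegeneration.limitDim, PlaneDegeneration.rP, PlaneDegeneration.rF,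
    PlaneDegeneration.ellP, PlaneDegeneration.ellF, PlaneDegeneration.ellHatP,
    PlaneDegeneration.ellHatF, PlaneDegeneration.ell_eq, hD']
  omega
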